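/- Let $m=(m_0,m_1,\dots)$ be a bounded sequence of integers $m_j\ge 2$, and let $G_m=\prod_{j\ge0}\mathbb Z/m_j\mathbb Z$ be the corresponding bounded Vilenkin group, a compact group with normalized Haar measure; let $\mu$ be the normalized Haar measure of $G_m^2=G_m\times G_m$. Put $M_0=1$, $M_{k+1}=m_kM_k$ and $I_n=\{x\in G_m: x_0=\dots=x_{n-1}=0\}$ (so $I_0=G_m$). For $n=\sum_j n_jM_j$ with $0\le n_j<m_j$ let $\psi_n(x)=\prod_j \exp(2\pi i\,n_jx_j/m_j)$ be the Vilenkin functions. For $f\in L^1(G_m^2)$ let $$\widehat f(n_1,n_2)=\int_{G_m^2} f(x,y)\,\overline{\psi_{n_1}(x)}\,\overline{\psi_{n_2}(y)}\,d\mu(x,y),\qquad S_{j,j}(f)(x,y)=\sum_{k_1=0}^{j-1}\sum_{k_2=0}^{j-1}\widehat f(k_1,k_2)\psi_{k_1}(x)\psi_{k_2}(y),$$ and for $\alpha\in(0,1)$ and $n\ge1$ let $$\sigma_n^{-\alpha}(f)=\frac1{A_{n-1}^{-\alpha}}\sum_{j=1}^n A_{n-j}^{-\alpha-1}S_{j,j}(f),\qquad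 A_0^\beta=1,\quad A_n^\beta=\frac{(\beta+1)\cdots(\beta+n)}{n!}.$$ For $1\le p<\infty$ let $\|\cdot\|_p$ be the norm of $L^p(G_m^2)$; for $p=\infty$ let $L^\infty(G_m^2)$ denote the space $C(G_m^2)$ of continuous complex functions with the supremum norm $\|\cdot\|_\infty$. The dyadic partial moduli of continuity are $$\omega_1(f,1/M_n)_p=\sup_{u\in I_n}\|f(\cdot+u,\cdot)-f\|_p,\qquad \omega_2(f,1/M_n)_p=\sup_{v\in I_n}\|f(\cdot,\cdot+v)-f\|_p .$$ Theorem. For every $\alpha\in(0,1)$ and every $B$ there is a constant $c$, depending only on $\alpha$ and $B$, such that for every sequence $m$ as above with $\sup_j m_j\le B$, every $p\in[1,\infty]$, every $f\in L^p(G_m^2)$ and every integer $k\ge1$, $$\|\sigma_{M_k}^{-\alpha}(f)-f\|_p\le c\Big(M_k^\alpha\,\omega_1(f,1/M_{k-1})_p+M_k^\alpha\,\omega_2(f,1/M_{k-1})_p+\sum_{r=0}^{k-2}\frac{M_r}{M_k}\big(\omega_1(f,1/M_r)_p+\omega_2(f,1/M_r)_p\big)\Big),$$ where the sum is empty for $k=1$.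 -/

import Mathlib

open MeasureTheory
open scoped NNReal ENNReal

noncomputable section

namespace Vilenkin

/-- The Vilenkin group `G_m`: the complete direct product of the cyclic groups `ℤ/m_k`, with
coordinatewise addition, the product topology and the product `σ`-algebra (each factor is
discrete). -/
abbrev Group (m : ℕ → ℕ) : Type := ∀ k, ZMod (m k)

/-- The Haar probability measure of `G_m`: the product of the uniform probability measures on the
factors `ℤ/m_k`. -/
def haar (m : ℕ → ℕ) [∀ k, NeZero (m k)] : Measure (Group m) :=
  Measure.infinitePi fun k => ProbabilityTheory.uniformOn (Set.univ : Set (ZMod (m k)))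

instance (m : ℕ → ℕ) [∀ k, NeZero (m k)] : IsProbabilityMeasure (haar m) := by
  unfold haar; infer_instance

/-- The Haar probability measure of `G_m × G_m`. -/
def haar₂ (m : ℕ → ℕ) [∀ k, NeZero (m k)] : Measure (Group m × Group m) :=
  (haar m).prod (haar m)

instance (m : ℕ → ℕ) [∀ k, NeZero (m k)] : IsProbabilityMeasure (haar₂ m) := by
  unfold haar₂; infer_instance

/-- The subgroup `I_n` of all `x` whose coordinates `x_0, …, x_{n-1}` vanish. -/
def cyl (m : ℕ → ℕ) (n : ℕ) : Set (Group m) := {x | ∀ i < n, x i = 0}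

/-- The generalized powers `M_0 = 1`, `M_{k+1} = m_k M_k`. -/
def M (m : ℕ → ℕ) : ℕ → ℕ
  | 0 => 1
  | k + 1 => m k * M m k

/-- The digits `n_k ∈ {0, …, m_k - 1}` of `n` in the expansion `n = ∑_k n_k M_k`. -/
def digit (m : ℕ → ℕ) (n k : ℕ) : ℕ := n / M m k % m k

/-- The generalized Rademacher functions `r_k(x) = exp(2πi x_k / m_k)`. -/
def rademacher (m : ℕ → ℕ) (k : ℕ) (x : Group m) : ℂ :=
  Complex.exp (2 * Real.pi * Complex.I * ((x k).val : ℂ) / (m k : ℂ))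

/-- The Vilenkin functions `ψ_n = ∏_k r_k ^ n_k`. All the digits `n_k` with `k ≥ n` vanish
(see `digit_eq_zero`), so that the product over `k < n` is the whole product. -/
def psi (m : ℕ → ℕ) (n : ℕ) (x : Group m) : ℂ :=
  ∏ k ∈ Finset.range n, rademacher m k x ^ digit m n k

lemma lt_M (m : ℕ → ℕ) (hm : ∀ k, 2 ≤ m k) (k : ℕ) : k < M m k := by
  induction k with
  | zero => simp [M]
  | succ k ih =>
    have h := Nat.mul_le_mul_right (M m k) (hm k)
    simp only [M]
    omega

lemma digit_eq_zero (m : ℕ → ℕ) (hm : ∀ k, 2 ≤ m k) {n k : ℕ} (h : n ≤ k) :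
    digit m n k = 0 := by
  simp [digit, Nat.div_eq_of_lt (h.trans_lt (lt_M m hm k))]

/-- The double Vilenkin–Fourier coefficients. -/
def fourierCoeff (m : ℕ → ℕ) [∀ k, NeZero (m k)] (f : Group m × Group m → ℂ) (n₁ n₂ : ℕ) : ℂ :=
  ∫ z, f z * starRingEnd ℂ (psi m n₁ z.1) * starRingEnd ℂ (psi m n₂ z.2) ∂(haar₂ m)

/-- The rectangular partial sums `S_{n₁,n₂}(f)`. -/
def partialSum (m : ℕ → ℕ) [∀ k, NeZero (m k)] (n₁ n₂ : ℕ) (f : Group m × Group m → ℂ)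
    (z : Group m × Group m) : ℂ :=
  ∑ k₁ ∈ Finset.range n₁, ∑ k₂ ∈ Finset.range n₂,
    fourierCoeff m f k₁ k₂ * psi m k₁ z.1 * psi m k₂ z.2

/-- The Cesàro numbers `A_n^a = (a+1)(a+2)⋯(a+n) / n!`, `A_0^a = 1`. -/
def cesaroNumber (a : ℝ) (n : ℕ) : ℝ := (∏ i ∈ Finset.range n, (a + (i + 1))) / (n.factorial : ℝ)

/-- The `(C, a)` means of the quadratic partial sums,
`σ_n^a(f) = (1 / A_{n-1}^a) ∑_{j=1}^n A_{n-j}^{a-1} S_{j,j}(f)`, for `n ≥ 1`. -/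
def cesaroMean (m : ℕ → ℕ) [∀ k, NeZero (m k)] (a : ℝ) (n : ℕ) (f : Group m × Group m → ℂ)
    (z : Group m × Group m) : ℂ :=
  (1 / cesaroNumber a (n - 1) : ℝ) *
    ∑ j ∈ Finset.Icc 1 n, (cesaroNumber (a - 1) (n - j) : ℂ) * partialSum m j j f z

/-- Membership in `L^p(G_m × G_m)`, where `L^∞` stands for the space of continuous functions. -/
def InLp (m : ℕ → ℕ) [∀ k, NeZero (m k)] (p : ℝ≥0∞) (f : Group m × Group m → ℂ) : Prop :=
  if p = ∞ then Continuous f else MemLp f p (haar₂ m)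

/-- The norm of `L^p(G_m × G_m)`: the integral norm for `p < ∞`, the supremum norm for `p = ∞`. -/
def normLp (m : ℕ → ℕ) [∀ k, NeZero (m k)] (p : ℝ≥0∞) (f : Group m × Group m → ℂ) : ℝ≥0∞ :=
  if p = ∞ then ⨆ z, ‖f z‖ₑ else eLpNorm f p (haar₂ m)

/-- The dyadic partial modulus of continuity `ω₁(f, 1/M_n)_p` in the first variable. -/
def modulus₁ (m : ℕ → ℕ) [∀ k, NeZero (m k)] (p : ℝ≥0∞) (f : Group m × Group m → ℂ) (n : ℕ) :
    ℝ≥0∞ :=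
  ⨆ u ∈ cyl m n, normLp m p fun z => f (z.1 + u, z.2) - f z

/-- The dyadic partial modulus of continuity `ω₂(f, 1/M_n)_p` in the second variable. -/
def modulus₂ (m : ℕ → ℕ) [∀ k, NeZero (m k)] (p : ℝ≥0∞) (f : Group m × Group m → ℂ) (n : ℕ) :
    ℝ≥0∞ :=
  ⨆ v ∈ cyl m n, normLp m p fun z => f (z.1, z.2 + v) - f z

end Vilenkin

end

/-!
Reindexing by `i = M_k - j` exhibits `σ_{M_k}^{-α} f - f` as a sum of the differences
`S_{j,j} f - f` with the weights `A_i^{-α-1} / A_{M_k-1}^{-α}`. The sum is cut at the powers `M_r`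
with `r < k`.

For `j ≥ M_r` the operator `S_{j,j}` fixes `S_{M_r,M_r} f`, so that on the block starting at `M_r`
the function `f` may be replaced by `S_{M_r,M_r} f - f`. Since `D_{M_r}` is the normalized
indicator of `I_r`, the latter is an average of differences of translates of `f` by elements of
`I_r × I_r`, and its norm is at most `ω₁(f, 1/M_r)_p + ω₂(f, 1/M_r)_p`. It remains to bound, for
each block, the `L¹` norm of the weighted sum of the kernels `D_j ⊗ D_j`; this norm also dominates
the total weight of the block, which is the integral of that sum.

The sequence `-A_i^{-α-1}`, `i ≥ 1`, is nonnegative, decreasing, of sum at most `1` and of size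
`O(i^{-1-α})`. Abel summation therefore reduces these bounds to linear bounds for the `L¹` norms of
the unnormalized Fejér and Marcinkiewicz kernels, which are proved by induction along the digits of
the index. In the top block, where the weights are largest near `j = M_k`, one first reflects
`D_{M_k - i} = D_{M_k} - ψ_{M_k - 1} · conj D_i`.
-/

noncomputable section

namespace Vilenkin

/-! ### Invariance of the Haar measures -/

section Invariance

instance isAddLeftInvariant_uniformOn_univ {X : Type*} [Finite X] [AddGroup X] [MeasurableSpace X]
    [MeasurableSingletonClass X] [MeasurableAdd X] :
    (ProbabilityTheory.uniformOn (Set.univ : Set X)).IsAddLeftInvariant := by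
  unfold ProbabilityTheory.uniformOn ProbabilityTheory.cond
  rw [Measure.restrict_univ]
  infer_instance

instance isAddLeftInvariant_infinitePi {ι : Type*} {X : ι → Type*} [∀ i, AddGroup (X i)]
    [∀ i, MeasurableSpace (X i)] [∀ i, MeasurableAdd (X i)] (μ : ∀ i, Measure (X i))
    [∀ i, IsProbabilityMeasure (μ i)] [∀ i, (μ i).IsAddLeftInvariant] :
    (Measure.infinitePi μ).IsAddLeftInvariant where
  map_add_left_eq_self g := by
    have h := Measure.infinitePi_map_pi (μ := μ) (f := fun i x => g i + x)
      fun i => measurable_const_add (g i)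
    simp only [map_add_left_eq_self] at h
    exact h

instance isAddLeftInvariant_haar (m : ℕ → ℕ) [∀ k, NeZero (m k)] :
    (haar m).IsAddLeftInvariant := by
  unfold haar; infer_instance

instance isAddLeftInvariant_haar₂ (m : ℕ → ℕ) [∀ k, NeZero (m k)] :
    (haar₂ m).IsAddLeftInvariant :=
  Measure.prod.instIsAddLeftInvariant

lemma integral_eq_zero_of_add_left_eq_mul {G : Type*} [AddGroup G] [MeasurableSpace G]
    [MeasurableAdd G] {μ : Measure G} [μ.IsAddLeftInvariant] {f : G → ℂ} {g : G} {c : ℂ}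
    (hc : c ≠ 1) (hf : ∀ x, f (g + x) = c * f x) : ∫ x, f x ∂μ = 0 := by
  have h := integral_add_left_eq_self (μ := μ) f g
  simp only [hf, integral_const_mul] at h
  exact (mul_left_eq_self₀.1 h).resolve_left hc

end Invariance

/-! ### Mixed radix expansions -/

section Digits

variable {m : ℕ → ℕ}

lemma mod_M_succ (n k : ℕ) : n % M m (k + 1) = n % M m k + M m k * digit m n k := by
  rw [M, mul_comm, Nat.mod_mul, digit]

lemma M_dvd_M {k r : ℕ} (h : k ≤ r) : M m k ∣ M m r := by
  induction r, h using Nat.le_induction with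
  | base => exact dvd_rfl
  | succ r _ ih => exact ih.trans (Dvd.intro_left _ rfl)

lemma block_lt_M {q i r : ℕ} (hq : q < m r) (hi : i < M m r) : q * M m r + i < M m (r + 1) :=
  calc q * M m r + i < (q + 1) * M m r := by rw [add_mul, one_mul]; gcongr
    _ ≤ M m (r + 1) := Nat.mul_le_mul_right _ hq

lemma eq_of_digit_eq (hm : ∀ k, 2 ≤ m k) {n n' : ℕ} (h : ∀ k, digit m n k = digit m n' k) :
    n = n' := by
  have hmod : ∀ k, n % M m k = n' % M m k := by
    intro k
    induction k with
    | zero => simp [M, Nat.mod_one]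
    | succ k ih => rw [mod_M_succ, mod_M_succ, ih, h]
  have hk := hmod (max n n')
  rwa [Nat.mod_eq_of_lt ((le_max_left _ _).trans_lt (lt_M m hm _)),
    Nat.mod_eq_of_lt ((le_max_right _ _).trans_lt (lt_M m hm _))] at hk

variable [∀ k, NeZero (m k)]

lemma M_pos (k : ℕ) : 0 < M m k := by
  induction k with
  | zero => exact one_pos
  | succ k ih => exact Nat.mul_pos (NeZero.pos (m k)) ih

lemma M_mono : Monotone (M m) := fun _ r h => Nat.le_of_dvd (M_pos r) (M_dvd_M h)

lemma digit_eq_zero_of_lt {n k r : ℕ} (hn : n < M m r) (hk : r ≤ k) : digit m n k = 0 := by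
  simp [digit, Nat.div_eq_of_lt (hn.trans_le (M_mono hk))]

lemma digit_block_of_lt (q i : ℕ) {k r : ℕ} (hk : k < r) :
    digit m (q * M m r + i) k = digit m i k := by
  obtain ⟨t, ht⟩ := M_dvd_M (m := m) (Nat.succ_le_of_lt hk)
  have h : q * M m r + i = i + M m k * (m k * (t * q)) := by rw [ht, M]; ring
  rw [digit, digit, h, Nat.add_mul_div_left _ _ (M_pos k), Nat.add_mul_mod_self_left]

lemma digit_block_self {q i r : ℕ} (hq : q < m r) (hi : i < M m r) :
    digit m (q * M m r + i) r = q := by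
  rw [digit, add_comm, Nat.add_mul_div_right _ _ (M_pos r), Nat.div_eq_of_lt hi, zero_add,
    Nat.mod_eq_of_lt hq]

lemma exists_eq_block {n r : ℕ} (hn : n < M m (r + 1)) :
    ∃ q i, q < m r ∧ i < M m r ∧ n = q * M m r + i :=
  ⟨n / M m r, n % M m r, Nat.div_lt_of_lt_mul (by rwa [mul_comm]), Nat.mod_lt _ (M_pos r),
    (Nat.div_add_mod' _ _).symm⟩

end Digits

/-! ### The Vilenkin functions -/

section Psi

variable {m : ℕ → ℕ} [∀ k, NeZero (m k)]

lemma rademacher_eq_stdAddChar (k : ℕ) (x : Group m) :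
    rademacher m k x = ZMod.stdAddChar (x k) := by
  rw [rademacher, ZMod.stdAddChar_apply, ZMod.toCircle_apply]

lemma rademacher_add (k : ℕ) (x y : Group m) :
    rademacher m k (x + y) = rademacher m k x * rademacher m k y := by
  simp only [rademacher_eq_stdAddChar, Pi.add_apply, AddChar.map_add_eq_mul]

lemma rademacher_eq_one {k : ℕ} {x : Group m} (hx : x k = 0) : rademacher m k x = 1 := by
  rw [rademacher_eq_stdAddChar, hx, AddChar.map_zero_eq_one]

lemma norm_rademacher (k : ℕ) (x : Group m) : ‖rademacher m k x‖ = 1 := by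
  rw [rademacher_eq_stdAddChar, ZMod.stdAddChar_apply, Circle.norm_coe]

lemma isPrimitiveRoot_rademacher_single (k : ℕ) :
    IsPrimitiveRoot (rademacher m k (Pi.single k 1)) (m k) := by
  rw [rademacher_eq_stdAddChar, Pi.single_eq_same, ← Int.cast_one, ZMod.stdAddChar_coe]
  convert Complex.isPrimitiveRoot_exp (m k) (NeZero.ne _) using 2
  push_cast; ring

/-- The generalized Rademacher function `r_k` as a continuous function. -/
def rademacherMap (m : ℕ → ℕ) [∀ k, NeZero (m k)] (k : ℕ) : C(Group m, ℂ) where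
  toFun := rademacher m k
  continuous_toFun := by
    rw [show rademacher m k = (fun t : ZMod (m k) => (ZMod.stdAddChar t : ℂ)) ∘ fun x => x k from
      funext (rademacher_eq_stdAddChar k)]
    exact continuous_of_discreteTopology.comp (continuous_apply k)

/-- The Vilenkin function `ψ_n` as a continuous function. -/
def psiMap (m : ℕ → ℕ) [∀ k, NeZero (m k)] (n : ℕ) : C(Group m, ℂ) :=
  ∏ k ∈ Finset.range n, rademacherMap m k ^ digit m n k

@[simp]
lemma rademacherMap_apply (k : ℕ) (x : Group m) : rademacherMap m k x = rademacher m k x := rfl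

@[simp]
lemma psiMap_apply (n : ℕ) (x : Group m) : psiMap m n x = psi m n x := by
  simp [psiMap, psi]

@[simp]
lemma psiMap_zero : psiMap m 0 = 1 := rfl

lemma psi_add (n : ℕ) (x y : Group m) : psi m n (x + y) = psi m n x * psi m n y := by
  simp only [psi, rademacher_add, mul_pow, Finset.prod_mul_distrib]

lemma norm_psi (n : ℕ) (x : Group m) : ‖psi m n x‖ = 1 := by
  simp [psi, norm_rademacher]

lemma psi_mul_conj (n : ℕ) (x : Group m) : psi m n x * starRingEnd ℂ (psi m n x) = 1 := by
  rw [Complex.mul_conj', norm_psi]; simp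

lemma psiMap_mul_star (n : ℕ) : psiMap m n * star (psiMap m n) = 1 := by
  ext x; simpa using psi_mul_conj n x

lemma psi_single (hm : ∀ k, 2 ≤ m k) (n k : ℕ) (t : ZMod (m k)) :
    psi m n (Pi.single k t) = rademacher m k (Pi.single k t) ^ digit m n k := by
  refine Finset.prod_eq_single k (fun j _ hj => ?_) fun hk => ?_
  · rw [rademacher_eq_one (Pi.single_eq_of_ne (M := fun k => ZMod (m k)) hj t), one_pow]
  · rw [digit_eq_zero m hm (by simpa using hk), pow_zero]

lemma psi_injective (hm : ∀ k, 2 ≤ m k) : Function.Injective (psi m) := fun n n' h =>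
  eq_of_digit_eq hm fun k => (isPrimitiveRoot_rademacher_single k).pow_inj
    (Nat.mod_lt _ (NeZero.pos _)) (Nat.mod_lt _ (NeZero.pos _)) <| by
      rw [← psi_single hm, ← psi_single hm, h]

lemma integral_psi_mul_conj (hm : ∀ k, 2 ≤ m k) (n n' : ℕ) :
    ∫ x, psi m n x * starRingEnd ℂ (psi m n' x) ∂haar m = if n = n' then 1 else 0 := by
  split_ifs with h
  · simp [h, psi_mul_conj]
  · obtain ⟨y, hy⟩ := Function.ne_iff.1 ((psi_injective hm).ne h)
    refine integral_eq_zero_of_add_left_eq_mul (g := y)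
      (c := psi m n y * starRingEnd ℂ (psi m n' y)) (fun hc => hy ?_) fun x => ?_
    · linear_combination psi m n' y * hc - psi m n y * psi_mul_conj n' y
    · rw [psi_add, psi_add, map_mul]; ring

lemma psiMap_eq_prod_range (hm : ∀ k, 2 ≤ m k) {n r : ℕ} (hn : n < M m r) :
    psiMap m n = ∏ k ∈ Finset.range r, rademacherMap m k ^ digit m n k := by
  rcases le_total n r with h | h
  · refine Finset.prod_subset (Finset.range_mono h) fun k _ hk => ?_
    rw [digit_eq_zero m hm (by simpa using hk), pow_zero]
  · refine (Finset.prod_subset (Finset.range_mono h) fun k _ hk => ?_).symm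
    rw [digit_eq_zero_of_lt hn (by simpa using hk), pow_zero]

lemma psiMap_block (hm : ∀ k, 2 ≤ m k) {q i r : ℕ} (hq : q < m r) (hi : i < M m r) :
    psiMap m (q * M m r + i) = rademacherMap m r ^ q * psiMap m i := by
  rw [psiMap_eq_prod_range hm (block_lt_M hq hi), Finset.prod_range_succ, digit_block_self hq hi,
    psiMap_eq_prod_range hm hi, mul_comm]
  congr 1
  exact Finset.prod_congr rfl fun k hk => by rw [digit_block_of_lt q i (Finset.mem_range.1 hk)]

lemma psi_eq_one_of_mem_cyl (hm : ∀ k, 2 ≤ m k) {n r : ℕ} (hn : n < M m r) {x : Group m}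
    (hx : x ∈ cyl m r) : psi m n x = 1 := by
  rw [← psiMap_apply, psiMap_eq_prod_range hm hn]
  simp only [ContinuousMap.coe_prod, Finset.prod_apply, ContinuousMap.coe_pow, Pi.pow_apply,
    rademacherMap_apply]
  exact Finset.prod_eq_one fun k hk => by
    rw [rademacher_eq_one (hx k (Finset.mem_range.1 hk)), one_pow]

lemma psi_add_of_mem_cyl (hm : ∀ k, 2 ≤ m k) {n r : ℕ} (hn : n < M m r) {x : Group m}
    (hx : x ∈ cyl m r) (y : Group m) : psi m n (x + y) = psi m n y := by
  rw [psi_add, psi_eq_one_of_mem_cyl hm hn hx, one_mul]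

lemma psiMap_reflect (hm : ∀ k, 2 ≤ m k) {r n : ℕ} (hn : n < M m r) :
    psiMap m (M m r - 1 - n) * psiMap m n = psiMap m (M m r - 1) := by
  induction r generalizing n with
  | zero => simp_all [M]
  | succ r ih =>
    obtain ⟨q, i, hq, hi, rfl⟩ := exists_eq_block hn
    obtain ⟨d, hd⟩ := Nat.exists_eq_add_of_lt hq
    have hM : M m (r + 1) = d * M m r + M m r + q * M m r := by rw [M, hd]; ring
    have h₁ : M m (r + 1) - 1 - (q * M m r + i) = d * M m r + (M m r - 1 - i) := by omega
    have h₂ : M m (r + 1) - 1 = (q + d) * M m r + (M m r - 1) := by rw [add_mul]; omega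
    rw [h₁, h₂, psiMap_block hm (by omega) (by omega), psiMap_block hm hq hi,
      psiMap_block hm (by omega) (by omega), ← ih hi]
    ring

end Psi

/-! ### The `L¹` norm of continuous kernels -/

section L1Norm

variable {X : Type*} [TopologicalSpace X] [CompactSpace X] [MeasurableSpace X]
  [OpensMeasurableSpace X]

lemma integrable_of_continuous {E : Type*} [NormedAddCommGroup E] (μ : Measure X)
    [IsFiniteMeasure μ] {f : X → E} (hf : Continuous f) : Integrable f μ :=
  hf.integrable_of_hasCompactSupport (HasCompactSupport.of_compactSpace _)

/-- The `L¹` norm of a continuous kernel. It is only a seminorm, since `μ` may fail to charge open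
sets. -/
def l1Norm (μ : Measure X) [IsFiniteMeasure μ] : Seminorm ℝ C(X, ℂ) :=
  Seminorm.of (fun K => ∫ x, ‖K x‖ ∂μ)
    (fun K L => by
      rw [← integral_add (integrable_of_continuous μ (by fun_prop))
        (integrable_of_continuous μ (by fun_prop))]
      exact integral_mono (integrable_of_continuous μ (by fun_prop))
        (integrable_of_continuous μ (by fun_prop)) fun x => norm_add_le _ _)
    fun c K => by simp only [ContinuousMap.smul_apply, norm_smul, integral_const_mul]

variable {μ : Measure X} [IsFiniteMeasure μ]

lemma l1Norm_apply (K : C(X, ℂ)) : l1Norm μ K = ∫ x, ‖K x‖ ∂μ := rfl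

lemma l1Norm_nsmul (n : ℕ) (K : C(X, ℂ)) : l1Norm μ (n • K) = n * l1Norm μ K := by
  rw [← Nat.cast_smul_eq_nsmul ℝ, map_smul_eq_mul, Real.norm_natCast]

lemma l1Norm_star (K : C(X, ℂ)) : l1Norm μ (star K) = l1Norm μ K := by
  simp [l1Norm_apply]

lemma l1Norm_one [IsProbabilityMeasure μ] : l1Norm μ 1 = 1 := by
  simp [l1Norm_apply]

lemma l1Norm_mul_of_norm_eq_one {R : C(X, ℂ)} (hR : ∀ x, ‖R x‖ = 1) (K : C(X, ℂ)) :
    l1Norm μ (R * K) = l1Norm μ K := by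
  simp [l1Norm_apply, hR]

lemma l1Norm_pow_mul_of_norm_eq_one {R : C(X, ℂ)} (hR : ∀ x, ‖R x‖ = 1) (n : ℕ) (K : C(X, ℂ)) :
    l1Norm μ (R ^ n * K) = l1Norm μ K :=
  l1Norm_mul_of_norm_eq_one (fun x => by simp [hR]) K

lemma sum_stdAddChar_pow {n : ℕ} [NeZero n] (t : ZMod n) :
    ∑ q ∈ Finset.range n, (ZMod.stdAddChar t : ℂ) ^ q = if t = 0 then (n : ℂ) else 0 := by
  split_ifs with h
  · simp [h]
  · have h1 : (ZMod.stdAddChar t : ℂ) ≠ 1 := fun h' =>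
      h (ZMod.injective_stdAddChar (by rw [h', AddChar.map_zero_eq_one]))
    rw [geom_sum_eq h1, ← AddChar.map_nsmul_eq_pow]
    simp

/-- Summing `|∑_{s < n} R ^ s|`, which is `n` where `φ = 0` and `0` elsewhere, over the translations
by the `e t` gives the constant `n`, while `|G|` does not change under these translations. -/
lemma l1Norm_geom_sum_mul [AddGroup X] [MeasurableAdd X] [μ.IsAddLeftInvariant] {n : ℕ} [NeZero n]
    {φ : X → ZMod n} {e : ZMod n → X} (hφ : ∀ t x, φ (e t + x) = t + φ x) {R G : C(X, ℂ)}
    (hR : ∀ x, R x = ZMod.stdAddChar (φ x)) (hG : ∀ t x, ‖G (e t + x)‖ = ‖G x‖) :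
    l1Norm μ ((∑ s ∈ Finset.range n, R ^ s) * G) = l1Norm μ G := by
  set S : C(X, ℂ) := ∑ s ∈ Finset.range n, R ^ s
  set H : ZMod n → ℝ := fun t => if t = 0 then n else 0
  have hS (x : X) : ‖S x‖ = H (φ x) := by
    simp only [S, H, ContinuousMap.sum_apply, ContinuousMap.pow_apply, hR, sum_stdAddChar_pow,
      apply_ite (‖·‖), RCLike.norm_natCast, norm_zero]
  have hsum (x : X) : ∑ t, ‖(S * G) (e t + x)‖ = n * ‖G x‖ := by
    simp only [ContinuousMap.mul_apply, norm_mul, hS, hφ, hG, ← Finset.sum_mul]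
    rw [Fintype.sum_equiv (Equiv.addRight (φ x)) (fun t => H (t + φ x)) H fun _ => rfl]
    simp [H]
  refine mul_left_cancel₀ (Nat.cast_ne_zero.2 (NeZero.ne n) : (n : ℝ) ≠ 0) ?_
  calc n * l1Norm μ (S * G) = ∑ t, ∫ x, ‖(S * G) (e t + x)‖ ∂μ := by
        simp only [integral_add_left_eq_self (μ := μ) fun x => ‖(S * G) x‖, l1Norm_apply,
          Finset.sum_const, Finset.card_univ, ZMod.card, nsmul_eq_mul]
    _ = ∫ x, ∑ t, ‖(S * G) (e t + x)‖ ∂μ := by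
        refine (integral_finsetSum _ fun t _ => ?_).symm
        exact (integrable_of_continuous μ (by fun_prop)).comp_add_left (e t)
          (f := fun x => ‖(S * G) x‖)
    _ = n * l1Norm μ G := by simp only [hsum, integral_const_mul, l1Norm_apply]

end L1Norm

section Tensor

variable {X Y : Type*} [TopologicalSpace X] [TopologicalSpace Y]

/-- The tensor product `(K ⊗ L)(x, y) = K(x) L(y)` of two kernels. -/
def tensor : C(X, ℂ) →ₗ[ℝ] C(Y, ℂ) →ₗ[ℝ] C(X × Y, ℂ) :=
  LinearMap.mk₂ ℝ (fun K L => K.comp ContinuousMap.fst * L.comp ContinuousMap.snd)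
    (fun _ _ _ => by ext; simp [add_mul]) (fun _ _ _ => by ext; simp [mul_assoc])
    (fun _ _ _ => by ext; simp [mul_add]) (fun _ _ _ => by ext; simp [mul_left_comm])

@[simp]
lemma tensor_apply (K : C(X, ℂ)) (L : C(Y, ℂ)) (z : X × Y) : tensor K L z = K z.1 * L z.2 := rfl

lemma tensor_mul_tensor (K₁ K₂ : C(X, ℂ)) (L₁ L₂ : C(Y, ℂ)) :
    tensor K₁ L₁ * tensor K₂ L₂ = tensor (K₁ * K₂) (L₁ * L₂) := by
  ext z; simp only [ContinuousMap.mul_apply, tensor_apply]; ring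

lemma tensor_pow (K : C(X, ℂ)) (L : C(Y, ℂ)) (n : ℕ) :
    tensor K L ^ n = tensor (K ^ n) (L ^ n) := by
  ext z; simp [mul_pow]

lemma l1Norm_tensor [CompactSpace X] [CompactSpace Y] [MeasurableSpace X] [OpensMeasurableSpace X]
    [MeasurableSpace Y] [OpensMeasurableSpace Y] [SecondCountableTopologyEither X Y]
    {μ : Measure X} [IsFiniteMeasure μ] {ν : Measure Y} [IsFiniteMeasure ν] (K : C(X, ℂ))
    (L : C(Y, ℂ)) : l1Norm (μ.prod ν) (tensor K L) = l1Norm μ K * l1Norm ν L := by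
  simp only [l1Norm_apply, tensor_apply, norm_mul]
  exact integral_prod_mul (fun x => ‖K x‖) fun y => ‖L y‖

end Tensor

/-! ### Dirichlet kernels -/

section Dirichlet

/-- The Dirichlet kernel `D_n = ∑_{i < n} ψ_i`. -/
def dirichlet (m : ℕ → ℕ) [∀ k, NeZero (m k)] (n : ℕ) : C(Group m, ℂ) :=
  ∑ i ∈ Finset.range n, psiMap m i

variable {m : ℕ → ℕ} [∀ k, NeZero (m k)]

lemma dirichlet_apply (n : ℕ) (x : Group m) :
    dirichlet m n x = ∑ i ∈ Finset.range n, psi m i x := by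
  simp [dirichlet, ContinuousMap.sum_apply]

@[simp]
lemma dirichlet_zero : dirichlet m 0 = 0 := rfl

@[simp]
lemma dirichlet_one : dirichlet m 1 = 1 := by simp [dirichlet]

lemma dirichlet_succ (n : ℕ) : dirichlet m (n + 1) = dirichlet m n + psiMap m n :=
  Finset.sum_range_succ _ _

lemma dirichlet_block (hm : ∀ k, 2 ≤ m k) {q i r : ℕ} (hq : q < m r) (hi : i ≤ M m r) :
    dirichlet m (q * M m r + i) =
      dirichlet m (q * M m r) + rademacherMap m r ^ q * dirichlet m i := by
  rw [dirichlet, Finset.sum_range_add, dirichlet, dirichlet, Finset.mul_sum]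
  congr 1
  exact Finset.sum_congr rfl fun j hj =>
    psiMap_block hm hq ((Finset.mem_range.1 hj).trans_le hi)

lemma dirichlet_mul_M (hm : ∀ k, 2 ≤ m k) {q r : ℕ} (hq : q ≤ m r) :
    dirichlet m (q * M m r) =
      (∑ s ∈ Finset.range q, rademacherMap m r ^ s) * dirichlet m (M m r) := by
  induction q with
  | zero => simp
  | succ q ih =>
    rw [Nat.succ_mul, dirichlet_block hm hq le_rfl, ih (by omega), Finset.sum_range_succ, add_mul]

open Classical in
lemma dirichlet_M_apply (hm : ∀ k, 2 ≤ m k) (r : ℕ) (x : Group m) :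
    dirichlet m (M m r) x = if x ∈ cyl m r then (M m r : ℂ) else 0 := by
  induction r with
  | zero => simp [M, cyl]
  | succ r ih =>
    have hcyl : x ∈ cyl m (r + 1) ↔ x ∈ cyl m r ∧ x r = 0 := by
      simp only [cyl, Set.mem_ofPred_eq, Nat.lt_succ_iff_lt_or_eq, or_imp, forall_and,
        forall_eq]
    rw [M, dirichlet_mul_M hm le_rfl]
    simp only [ContinuousMap.mul_apply, ContinuousMap.sum_apply, ContinuousMap.pow_apply,
      rademacherMap_apply, rademacher_eq_stdAddChar, sum_stdAddChar_pow, ih, hcyl, ite_and,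
      ite_mul, mul_ite, zero_mul, mul_zero, Nat.cast_mul]

lemma dirichlet_reflect (hm : ∀ k, 2 ≤ m k) {r i : ℕ} (hi : i ≤ M m r) :
    dirichlet m (M m r - i) =
      dirichlet m (M m r) - psiMap m (M m r - 1) * star (dirichlet m i) := by
  induction i with
  | zero => simp
  | succ i ih =>
    have hpsi : psiMap m (M m r - 1 - i) = psiMap m (M m r - 1) * star (psiMap m i) := by
      rw [← psiMap_reflect hm hi, mul_assoc, psiMap_mul_star, mul_one]
    have h := ih (by omega)
    rw [show M m r - i = M m r - 1 - i + 1 by omega, dirichlet_succ, hpsi] at h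
    rw [show M m r - (i + 1) = M m r - 1 - i by omega, eq_sub_of_add_eq h, dirichlet_succ,
      star_add]
    ring

lemma dirichlet_add_of_mem_cyl (hm : ∀ k, 2 ≤ m k) {n r : ℕ} (hn : n ≤ M m r) {u : Group m}
    (hu : u ∈ cyl m r) (x : Group m) : dirichlet m n (u + x) = dirichlet m n x := by
  simp only [dirichlet_apply]
  exact Finset.sum_congr rfl fun j hj =>
    psi_add_of_mem_cyl hm ((Finset.mem_range.1 hj).trans_le hn) hu x

lemma integral_dirichlet (hm : ∀ k, 2 ≤ m k) {n : ℕ} (hn : 0 < n) :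
    ∫ x, dirichlet m n x ∂haar m = 1 := by
  have h (i : ℕ) : ∫ x, psi m i x ∂haar m = if i = 0 then 1 else 0 := by
    simpa [psi] using integral_psi_mul_conj hm i 0
  simp only [dirichlet, ContinuousMap.sum_apply]
  rw [integral_finsetSum _ fun i _ => integrable_of_continuous _ (psiMap m i).continuous]
  simp [h, hn]

end Dirichlet

/-! ### Fejér and Marcinkiewicz kernels -/

section BlockRecursion

variable {m : ℕ → ℕ}

lemma one_le_bound (hm : ∀ k, 2 ≤ m k) {B : ℕ} (hB : ∀ k, m k ≤ B) : (1 : ℝ) ≤ B :=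
  Nat.one_le_cast.2 (one_le_two.trans ((hm 0).trans (hB 0)))

lemma single_mem_cyl (r : ℕ) (t : ZMod (m r)) : (Pi.single r t : Group m) ∈ cyl m r :=
  fun _ hi => Pi.single_eq_of_ne (M := fun k => ZMod (m k)) hi.ne t

lemma seminorm_sum_le {E ι : Type*} [AddCommGroup E] [Module ℝ E] (p : Seminorm ℝ E)
    (s : Finset ι) (f : ι → E) : p (∑ i ∈ s, f i) ≤ ∑ i ∈ s, p (f i) :=
  Finset.le_sum_of_subadditive p (map_zero p).le (map_add_le_add p) s f

variable [∀ k, NeZero (m k)]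

lemma le_of_block_recursion (hm : ∀ k, 2 ≤ m k) {a : ℕ → ℝ} {C C' : ℝ} (hC : 0 ≤ C) (hC' : 0 ≤ C')
    (h0 : a 0 = 0) (h1 : a 1 ≤ C')
    (hblock : ∀ r q L, q < m r → L ≤ M m r → a (q * M m r + L) ≤ a (q * M m r) + (C * M m r + a L))
    (hfull : ∀ r, a (M m (r + 1)) ≤ C' * M m r + a (M m r)) (n : ℕ) :
    a n ≤ (2 * C + C') * n := by
  have hM (r : ℕ) : a (M m r) ≤ C' * M m r := by
    induction r with
    | zero => simpa [M] using h1
    | succ r ih =>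
      have htwo : (2 : ℝ) * M m r ≤ M m (r + 1) := by
        exact_mod_cast Nat.mul_le_mul_right (M m r) (hm r)
      linarith [hfull r, mul_le_mul_of_nonneg_left htwo hC']
  have hqM (r q : ℕ) (hq : q ≤ m r) : a (q * M m r) ≤ (C + C') * (q * M m r : ℕ) := by
    induction q with
    | zero => simp [h0]
    | succ q ih =>
      have h := hblock r q (M m r) hq le_rfl
      rw [Nat.succ_mul]
      push_cast at ih ⊢
      linarith [ih (by omega), hM r]
  suffices h : ∀ r n, n < M m r → a n ≤ (2 * C + C') * n from h n n (lt_M m hm n)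
  intro r
  induction r with
  | zero => intro n hn; simp_all [M]
  | succ r ih =>
    intro n hn
    obtain ⟨q, i, hq, hi, rfl⟩ := exists_eq_block hn
    rcases Nat.eq_zero_or_pos q with rfl | hq0
    · simpa using ih i hi
    · have hle : C * M m r ≤ C * (q * M m r : ℕ) := by
        gcongr; exact Nat.le_mul_of_pos_left _ hq0
      push_cast at hle ⊢
      have h := hqM r q hq.le
      push_cast at h
      linarith [hblock r q i hq hi.le, ih i hi]

/-- Along the full block `[0, m_r M_r)`, the translates `R_r ^ s * K (M_r)` have to be summed before
taking norms: bounding them one by one would only give `‖K (M_r)‖₁ = O(r M_r)`. -/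
lemma l1Norm_le_of_block (hm : ∀ k, 2 ≤ m k) {B : ℕ} (hB : ∀ k, m k ≤ B) {X : Type*}
    [TopologicalSpace X] [CompactSpace X] [MeasurableSpace X] [OpensMeasurableSpace X]
    {μ : Measure X} [IsFiniteMeasure μ] {K R : ℕ → C(X, ℂ)} {C : ℝ} (h0 : K 0 = 0)
    (h1 : l1Norm μ (K 1) ≤ B * C) (hR : ∀ r x, ‖R r x‖ = 1)
    (hblock : ∀ r q L, q < m r → L ≤ M m r →
      l1Norm μ (K (q * M m r + L) - K (q * M m r) - R r ^ q * K L) ≤ C * M m r)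
    (hgeom : ∀ r, l1Norm μ ((∑ s ∈ Finset.range (m r), R r ^ s) * K (M m r)) ≤
      l1Norm μ (K (M m r))) (n : ℕ) :
    l1Norm μ (K n) ≤ (B + 2) * C * n := by
  have hC : 0 ≤ C := by
    simpa [M] using (apply_nonneg _ _).trans (hblock 0 0 0 (NeZero.pos _) (Nat.zero_le _))
  have hfull (r : ℕ) : l1Norm μ (K (M m (r + 1))) ≤ B * C * M m r + l1Norm μ (K (M m r)) := by
    have htel : K (M m (r + 1)) =
        ∑ q ∈ Finset.range (m r), (K (q * M m r + M m r) - K (q * M m r) - R r ^ q * K (M m r)) +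
          (∑ s ∈ Finset.range (m r), R r ^ s) * K (M m r) := by
      simp only [Finset.sum_sub_distrib, ← Nat.succ_mul, Finset.sum_mul, sub_add_cancel]
      rw [← Finset.sum_sub_distrib, Finset.sum_range_sub fun q => K (q * M m r)]
      simp [h0, M]
    rw [htel]
    refine (map_add_le_add _ _ _).trans (add_le_add ?_ (hgeom r))
    calc _ ≤ ∑ _q ∈ Finset.range (m r), C * M m r :=
          (seminorm_sum_le _ _ _).trans <|
            Finset.sum_le_sum fun q hq => hblock r q _ (Finset.mem_range.1 hq) le_rfl
      _ ≤ B * C * M m r := by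
          rw [Finset.sum_const, Finset.card_range, nsmul_eq_mul, mul_assoc (B : ℝ)]
          gcongr
          exact hB r
  rw [add_mul, add_comm]
  refine le_of_block_recursion hm (a := fun n => l1Norm μ (K n)) hC (by positivity) (by simp [h0])
    h1 (fun r q L hq hL => ?_) hfull n
  calc l1Norm μ (K (q * M m r + L)) = l1Norm μ (K (q * M m r) +
        ((K (q * M m r + L) - K (q * M m r) - R r ^ q * K L) + R r ^ q * K L)) := by
        congr 1; abel
    _ ≤ l1Norm μ (K (q * M m r)) + (C * M m r + l1Norm μ (K L)) := by
        refine (map_add_le_add _ _ _).trans (add_le_add_right ?_ _)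
        refine (map_add_le_add _ _ _).trans (add_le_add (hblock r q L hq hL) ?_)
        exact (l1Norm_pow_mul_of_norm_eq_one (hR r) q _).le

end BlockRecursion

section Kernels

/-- The unnormalized Fejér kernel `D_1 + ⋯ + D_L`. -/
def fejer (m : ℕ → ℕ) [∀ k, NeZero (m k)] (L : ℕ) : C(Group m, ℂ) :=
  ∑ i ∈ Finset.range L, dirichlet m (i + 1)

/-- The kernel `D_n ⊗ D_n` of the quadratic partial sum `S_{n,n}`. -/
def dirichlet₂ (m : ℕ → ℕ) [∀ k, NeZero (m k)] (n : ℕ) : C(Group m × Group m, ℂ) :=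
  tensor (dirichlet m n) (dirichlet m n)

/-- The unnormalized Marcinkiewicz kernel `D_1 ⊗ D_1 + ⋯ + D_L ⊗ D_L`. -/
def marcinkiewicz (m : ℕ → ℕ) [∀ k, NeZero (m k)] (L : ℕ) : C(Group m × Group m, ℂ) :=
  ∑ i ∈ Finset.range L, dirichlet₂ m (i + 1)

/-- A constant for the linear growth of the `L¹` norms of the Fejér kernels. -/
def fejerConst (B : ℕ) : ℝ := (B + 2) * B

/-- A constant for the linear growth of the `L¹` norms of the Marcinkiewicz kernels. -/
def marcinkiewiczConst (B : ℕ) : ℝ := (B + 2) * (B * B + 2 * B * fejerConst B)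

lemma fejerConst_nonneg (B : ℕ) : 0 ≤ fejerConst B := by unfold fejerConst; positivity

lemma marcinkiewiczConst_nonneg (B : ℕ) : 0 ≤ marcinkiewiczConst B := by
  have := fejerConst_nonneg B
  unfold marcinkiewiczConst; positivity

variable {m : ℕ → ℕ} [∀ k, NeZero (m k)]

lemma l1Norm_haar₂_tensor (K L : C(Group m, ℂ)) :
    l1Norm (haar₂ m) (tensor K L) = l1Norm (haar m) K * l1Norm (haar m) L :=
  l1Norm_tensor K L

lemma l1Norm_dirichlet_M (hm : ∀ k, 2 ≤ m k) (r : ℕ) :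
    l1Norm (haar m) (dirichlet m (M m r)) = 1 := by
  have h : ∀ x, (‖dirichlet m (M m r) x‖ : ℂ) = dirichlet m (M m r) x := fun x => by
    rw [dirichlet_M_apply hm]; split_ifs <;> simp
  rw [← Complex.ofReal_inj, l1Norm_apply, ← integral_complex_ofReal]
  simp only [h, integral_dirichlet hm (M_pos r), Complex.ofReal_one]

lemma l1Norm_dirichlet_mul_M_le (hm : ∀ k, 2 ≤ m k) {r q : ℕ} (hq : q ≤ m r) :
    l1Norm (haar m) (dirichlet m (q * M m r)) ≤ q := by
  rw [dirichlet_mul_M hm hq, Finset.sum_mul]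
  refine (seminorm_sum_le _ _ _).trans_eq ?_
  simp [l1Norm_pow_mul_of_norm_eq_one (R := rademacherMap m r) (norm_rademacher r),
    l1Norm_dirichlet_M hm]

lemma fejer_block (hm : ∀ k, 2 ≤ m k) {q L r : ℕ} (hq : q < m r) (hL : L ≤ M m r) :
    fejer m (q * M m r + L) - fejer m (q * M m r) - rademacherMap m r ^ q * fejer m L =
      L • dirichlet m (q * M m r) := by
  have h : ∀ i ∈ Finset.range L, dirichlet m (q * M m r + i + 1) =
      dirichlet m (q * M m r) + rademacherMap m r ^ q * dirichlet m (i + 1) := fun i hi =>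
    dirichlet_block hm hq (Nat.succ_le_of_lt (Finset.mem_range.1 hi) |>.trans hL)
  rw [fejer, Finset.sum_range_add, Finset.sum_congr rfl h, Finset.sum_add_distrib,
    ← Finset.mul_sum, Finset.sum_const, Finset.card_range, fejer, fejer]
  abel

lemma marcinkiewicz_block (hm : ∀ k, 2 ≤ m k) {q L r : ℕ} (hq : q < m r) (hL : L ≤ M m r) :
    marcinkiewicz m (q * M m r + L) - marcinkiewicz m (q * M m r) -
        tensor (rademacherMap m r) (rademacherMap m r) ^ q * marcinkiewicz m L =
      L • tensor (dirichlet m (q * M m r)) (dirichlet m (q * M m r)) +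
        tensor (dirichlet m (q * M m r)) (rademacherMap m r ^ q * fejer m L) +
        tensor (rademacherMap m r ^ q * fejer m L) (dirichlet m (q * M m r)) := by
  have h : ∀ i ∈ Finset.range L, dirichlet m (q * M m r + i + 1) =
      dirichlet m (q * M m r) + rademacherMap m r ^ q * dirichlet m (i + 1) := fun i hi =>
    dirichlet_block hm hq (Nat.succ_le_of_lt (Finset.mem_range.1 hi) |>.trans hL)
  have hconst (T : C(Group m × Group m, ℂ)) : L • T = ∑ _i ∈ Finset.range L, T := by simp
  rw [marcinkiewicz, Finset.sum_range_add, marcinkiewicz, marcinkiewicz, add_sub_cancel_left,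
    hconst, fejer]
  simp only [Finset.mul_sum, map_sum, LinearMap.sum_apply, ← Finset.sum_sub_distrib,
    ← Finset.sum_add_distrib]
  refine Finset.sum_congr rfl fun i hi => ?_
  rw [dirichlet₂, h i hi, dirichlet₂, tensor_pow, tensor_mul_tensor]
  simp only [map_add, LinearMap.add_apply]
  abel

lemma fejer_add_of_mem_cyl (hm : ∀ k, 2 ≤ m k) {r : ℕ} {u : Group m} (hu : u ∈ cyl m r)
    (x : Group m) : fejer m (M m r) (u + x) = fejer m (M m r) x := by
  simp only [fejer, ContinuousMap.sum_apply]
  exact Finset.sum_congr rfl fun i hi => dirichlet_add_of_mem_cyl hm (Finset.mem_range.1 hi) hu x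

lemma marcinkiewicz_add_of_mem_cyl (hm : ∀ k, 2 ≤ m k) {r : ℕ} {v : Group m} (hv : v ∈ cyl m r)
    (z : Group m × Group m) : marcinkiewicz m (M m r) ((0, v) + z) = marcinkiewicz m (M m r) z := by
  simp only [marcinkiewicz, dirichlet₂, ContinuousMap.sum_apply, tensor_apply, Prod.fst_add,
    Prod.snd_add, zero_add]
  exact Finset.sum_congr rfl fun i hi => by
    rw [dirichlet_add_of_mem_cyl hm (Finset.mem_range.1 hi) hv]

lemma l1Norm_geom_sum_mul_fejer (hm : ∀ k, 2 ≤ m k) (r : ℕ) :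
    l1Norm (haar m) ((∑ s ∈ Finset.range (m r), rademacherMap m r ^ s) * fejer m (M m r)) =
      l1Norm (haar m) (fejer m (M m r)) :=
  l1Norm_geom_sum_mul (φ := fun x : Group m => x r) (e := fun t => Pi.single r t) (by simp)
    (rademacher_eq_stdAddChar r) fun t x => by rw [fejer_add_of_mem_cyl hm (single_mem_cyl r t)]

lemma l1Norm_geom_sum_mul_marcinkiewicz (hm : ∀ k, 2 ≤ m k) (r : ℕ) :
    l1Norm (haar₂ m) ((∑ s ∈ Finset.range (m r),
        tensor (rademacherMap m r) (rademacherMap m r) ^ s) * marcinkiewicz m (M m r)) =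
      l1Norm (haar₂ m) (marcinkiewicz m (M m r)) :=
  l1Norm_geom_sum_mul (φ := fun z : Group m × Group m => z.1 r + z.2 r)
    (e := fun t => (0, Pi.single r t))
    (fun t z => by simp [add_left_comm])
    (fun z => by simp only [tensor_apply, rademacherMap_apply, rademacher_eq_stdAddChar,
      AddChar.map_add_eq_mul])
    fun t z => by rw [marcinkiewicz_add_of_mem_cyl hm (single_mem_cyl r t)]

lemma l1Norm_fejer_le (hm : ∀ k, 2 ≤ m k) {B : ℕ} (hB : ∀ k, m k ≤ B) (n : ℕ) :
    l1Norm (haar m) (fejer m n) ≤ fejerConst B * n := by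
  refine l1Norm_le_of_block hm hB (R := rademacherMap m) rfl ?_ norm_rademacher
    (fun r q L hq hL => ?_) (fun r => (l1Norm_geom_sum_mul_fejer hm r).le) n
  · simpa [fejer, l1Norm_one] using
      one_le_mul_of_one_le_of_one_le (one_le_bound hm hB) (one_le_bound hm hB)
  · rw [fejer_block hm hq hL, l1Norm_nsmul, mul_comm]
    gcongr
    exact (l1Norm_dirichlet_mul_M_le hm hq.le).trans (Nat.cast_le.2 (hq.le.trans (hB r)))

lemma l1Norm_marcinkiewicz_block_le (hm : ∀ k, 2 ≤ m k) {B : ℕ} (hB : ∀ k, m k ≤ B) {q L r : ℕ}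
    (hq : q < m r) (hL : L ≤ M m r) :
    l1Norm (haar₂ m) (marcinkiewicz m (q * M m r + L) - marcinkiewicz m (q * M m r) -
        tensor (rademacherMap m r) (rademacherMap m r) ^ q * marcinkiewicz m L) ≤
      (B * B + 2 * B * fejerConst B) * M m r := by
  have hD : l1Norm (haar m) (dirichlet m (q * M m r)) ≤ B :=
    (l1Norm_dirichlet_mul_M_le hm hq.le).trans (Nat.cast_le.2 (hq.le.trans (hB r)))
  have hF : l1Norm (haar m) (rademacherMap m r ^ q * fejer m L) ≤ fejerConst B * M m r := by
    rw [l1Norm_pow_mul_of_norm_eq_one (norm_rademacher r)]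
    refine (l1Norm_fejer_le hm hB L).trans ?_
    unfold fejerConst
    gcongr
  have hL' : (L : ℝ) ≤ M m r := Nat.cast_le.2 hL
  have hc : 0 ≤ fejerConst B := fejerConst_nonneg B
  rw [marcinkiewicz_block hm hq hL]
  refine (map_add_le_add _ _ _).trans (add_le_add_left (map_add_le_add _ _ _) _ |>.trans ?_)
  rw [l1Norm_nsmul, l1Norm_haar₂_tensor, l1Norm_haar₂_tensor, l1Norm_haar₂_tensor]
  calc _ ≤ M m r * ((B : ℝ) * B) + B * (fejerConst B * M m r) + fejerConst B * M m r * B := by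
        gcongr
    _ = _ := by ring

lemma l1Norm_marcinkiewicz_le (hm : ∀ k, 2 ≤ m k) {B : ℕ} (hB : ∀ k, m k ≤ B) (n : ℕ) :
    l1Norm (haar₂ m) (marcinkiewicz m n) ≤ marcinkiewiczConst B * n := by
  have hB1 := one_le_bound hm hB
  refine l1Norm_le_of_block hm hB
    (R := fun r => tensor (rademacherMap m r) (rademacherMap m r)) rfl ?_
    (fun r z => by simp [norm_rademacher])
    (fun r q L hq hL => l1Norm_marcinkiewicz_block_le hm hB hq hL)
    (fun r => (l1Norm_geom_sum_mul_marcinkiewicz hm r).le) n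
  calc l1Norm (haar₂ m) (marcinkiewicz m 1) = 1 := by
        simp [marcinkiewicz, dirichlet₂, l1Norm_haar₂_tensor, l1Norm_one]
    _ ≤ B * (B * B) := one_le_mul_of_one_le_of_one_le hB1 (one_le_mul_of_one_le_of_one_le hB1 hB1)
    _ ≤ B * (B * B + 2 * B * fejerConst B) := by
        unfold fejerConst
        gcongr
        exact le_add_of_nonneg_right (by positivity)

end Kernels

/-! ### Cesàro numbers -/

section CesaroNumber

lemma cesaroNumber_zero (a : ℝ) : cesaroNumber a 0 = 1 := by simp [cesaroNumber]

lemma cesaroNumber_succ (a : ℝ) (n : ℕ) :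
    cesaroNumber a (n + 1) = (1 + a / (n + 1)) * cesaroNumber a n := by
  rw [cesaroNumber, cesaroNumber, Finset.prod_range_succ, Nat.factorial_succ]
  push_cast
  field_simp
  ring

lemma cesaroNumber_sub_one_succ (a : ℝ) (n : ℕ) :
    cesaroNumber (a - 1) (n + 1) = a / (n + 1) * cesaroNumber a n := by
  have h (i : ℕ) : a - 1 + ((i + 1 : ℕ) + 1) = a + (i + 1 : ℝ) := by push_cast; ring
  rw [cesaroNumber, cesaroNumber, Finset.prod_range_succ', Nat.factorial_succ]
  simp only [h]
  push_cast
  field_simp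
  ring

lemma sum_cesaroNumber (a : ℝ) (n : ℕ) :
    ∑ i ∈ Finset.range (n + 1), cesaroNumber (a - 1) i = cesaroNumber a n := by
  induction n with
  | zero => simp [cesaroNumber_zero]
  | succ n ih =>
    rw [Finset.sum_range_succ, ih, cesaroNumber_sub_one_succ, cesaroNumber_succ]
    ring

variable {α : ℝ}

lemma cesaroNumber_neg_pos (hα : α < 1) (n : ℕ) : 0 < cesaroNumber (-α) n :=
  div_pos (Finset.prod_pos fun i _ => by linarith [(Nat.cast_nonneg i : (0 : ℝ) ≤ i)])
    (by positivity)

lemma cesaroNumber_neg_antitone (hα₀ : 0 ≤ α) (hα₁ : α < 1) : Antitone (cesaroNumber (-α)) := by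
  refine antitone_nat_of_succ_le fun n => ?_
  rw [cesaroNumber_succ, neg_div]
  exact mul_le_of_le_one_left (cesaroNumber_neg_pos hα₁ n).le
    (by linarith [show 0 ≤ α / (n + 1) by positivity])

lemma cesaroNumber_neg_le (hα₀ : 0 ≤ α) (hα₁ : α < 1) (n : ℕ) :
    cesaroNumber (-α) n ≤ ((n : ℝ) + 1) ^ (-α) := by
  induction n with
  | zero => simp [cesaroNumber_zero]
  | succ n ih =>
    set t : ℝ := 1 / (n + 1) with ht
    have ht0 : 0 < t := by positivity
    have hbern : (1 + t) ^ α ≤ 1 + α * t :=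
      rpow_one_add_le_one_add_mul_self (by linarith) hα₀ hα₁.le
    have hfactor : 1 + -α / ((n : ℝ) + 1) ≤ (1 + t) ^ (-α) := by
      rw [Real.rpow_neg (by positivity), ← one_div, le_div_iff₀ (by positivity)]
      have ht1 : t ≤ 1 := (div_le_one (by positivity)).2 (by linarith [n.cast_nonneg (α := ℝ)])
      have h : 0 ≤ 1 - α * t := by linarith [mul_le_one₀ hα₁.le ht0.le ht1]
      calc (1 + -α / ((n : ℝ) + 1)) * (1 + t) ^ α = (1 - α * t) * (1 + t) ^ α := by
            rw [ht]; ring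
        _ ≤ (1 - α * t) * (1 + α * t) := by gcongr
        _ ≤ 1 := by linarith [mul_self_nonneg (α * t)]
    calc cesaroNumber (-α) (n + 1)
        ≤ (1 + t) ^ (-α) * ((n : ℝ) + 1) ^ (-α) := by
          rw [cesaroNumber_succ]
          exact mul_le_mul hfactor ih (cesaroNumber_neg_pos hα₁ n).le (by positivity)
      _ = (((n + 1 : ℕ) : ℝ) + 1) ^ (-α) := by
          rw [← Real.mul_rpow (by positivity) (by positivity), ht]
          congr 1
          push_cast
          field_simp

lemma le_cesaroNumber_neg (hα₀ : 0 ≤ α) (hα₁ : α < 1) {n : ℕ} (hn : 1 ≤ n) :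
    (1 - α) * (n : ℝ) ^ (-α) ≤ cesaroNumber (-α) n := by
  induction n, hn using Nat.le_induction with
  | base => simp [cesaroNumber_succ, cesaroNumber_zero, sub_eq_add_neg]
  | succ n hn ih =>
    have hn0 : (0 : ℝ) < n := by exact_mod_cast hn
    set t : ℝ := -(1 / (n + 1)) with ht
    have ht1 : 1 + t = n / (n + 1) := by rw [ht]; field_simp; ring
    have hbern : (1 + t) ^ α ≤ 1 + α * t :=
      rpow_one_add_le_one_add_mul_self (by linarith [show 0 ≤ 1 + t by rw [ht1]; positivity])
        hα₀ hα₁.le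
    calc (1 - α) * ((n + 1 : ℕ) : ℝ) ^ (-α) = (1 + t) ^ α * ((1 - α) * (n : ℝ) ^ (-α)) := by
          rw [ht1, Real.div_rpow hn0.le (by positivity), Real.rpow_neg hn0.le,
            Real.rpow_neg (by positivity)]
          push_cast
          field_simp
      _ ≤ (1 + α * t) * cesaroNumber (-α) n :=
          mul_le_mul hbern ih (mul_nonneg (by linarith) (by positivity))
            ((Real.rpow_nonneg (by rw [ht1]; positivity) _).trans hbern)
      _ = cesaroNumber (-α) (n + 1) := by rw [cesaroNumber_succ, ht]; ring

lemma one_div_cesaroNumber_neg_le (hα₀ : 0 ≤ α) (hα₁ : α < 1) {n : ℕ} (hn : 1 ≤ n) :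
    1 / cesaroNumber (-α) (n - 1) ≤ (1 - α)⁻¹ * (n : ℝ) ^ α := by
  have hn0 : (0 : ℝ) < n := by exact_mod_cast hn
  have h1 : 0 < 1 - α := by linarith
  calc 1 / cesaroNumber (-α) (n - 1) ≤ 1 / ((1 - α) * (n : ℝ) ^ (-α)) :=
        one_div_le_one_div_of_le (by positivity) <| (le_cesaroNumber_neg hα₀ hα₁ hn).trans
          (cesaroNumber_neg_antitone hα₀ hα₁ (Nat.sub_le n 1))
    _ = (1 - α)⁻¹ * (n : ℝ) ^ α := by rw [Real.rpow_neg hn0.le]; field_simp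

lemma neg_cesaroNumber_succ (n : ℕ) :
    -cesaroNumber (-α - 1) (n + 1) = α / (n + 1) * cesaroNumber (-α) n := by
  rw [cesaroNumber_sub_one_succ]; ring

lemma neg_cesaroNumber_succ_nonneg (hα₀ : 0 ≤ α) (hα₁ : α < 1) (n : ℕ) :
    0 ≤ -cesaroNumber (-α - 1) (n + 1) := by
  rw [neg_cesaroNumber_succ]
  have := (cesaroNumber_neg_pos hα₁ n).le
  positivity

lemma neg_cesaroNumber_succ_antitone (hα₀ : 0 ≤ α) (hα₁ : α < 1) :
    Antitone fun n => -cesaroNumber (-α - 1) (n + 1) := by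
  refine antitone_nat_of_succ_le fun n => ?_
  have h0 := (cesaroNumber_neg_pos hα₁ (n + 1)).le
  have h1 := cesaroNumber_neg_antitone hα₀ hα₁ (Nat.le_succ n)
  simp only [neg_cesaroNumber_succ]
  gcongr
  exact Nat.le_succ n

lemma neg_cesaroNumber_succ_le (hα₀ : 0 ≤ α) (hα₁ : α < 1) (n : ℕ) :
    -cesaroNumber (-α - 1) (n + 1) ≤ ((n : ℝ) + 1) ^ (-1 - α) := by
  have hn : (0 : ℝ) < n + 1 := by positivity
  have h0 := (cesaroNumber_neg_pos hα₁ n).le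
  rw [neg_cesaroNumber_succ, sub_eq_add_neg, Real.rpow_add hn, Real.rpow_neg_one, ← one_div]
  gcongr
  exact cesaroNumber_neg_le hα₀ hα₁ n

lemma sum_neg_cesaroNumber_succ_le_one (hα : α < 1) (n : ℕ) :
    ∑ i ∈ Finset.range n, -cesaroNumber (-α - 1) (i + 1) ≤ 1 := by
  have h := sum_cesaroNumber (-α) n
  rw [Finset.sum_range_succ', cesaroNumber_zero] at h
  rw [Finset.sum_neg_distrib]
  linarith [cesaroNumber_neg_pos hα n]

end CesaroNumber

section AbelSummation

variable {E : Type*} [AddCommGroup E] [Module ℝ E] (p : Seminorm ℝ E) {u : ℕ → ℝ} {G : ℕ → E}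

lemma seminorm_sum_smul_le_of_antitone (hu : Antitone u) (hu0 : ∀ i, 0 ≤ u i) {g : ℕ → ℝ}
    (hG : ∀ n, p (∑ i ∈ Finset.range n, G i) ≤ ∑ i ∈ Finset.range n, g i) (n : ℕ) :
    p (∑ i ∈ Finset.range n, u i • G i) ≤ ∑ i ∈ Finset.range n, u i * g i := by
  have hg := Finset.sum_range_by_parts u g n
  simp only [smul_eq_mul] at hg
  rw [Finset.sum_range_by_parts, hg, sub_eq_add_neg, sub_eq_add_neg, ← Finset.sum_neg_distrib,
    ← Finset.sum_neg_distrib]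
  refine (map_add_le_add _ _ _).trans (add_le_add ?_ ?_)
  · rw [map_smul_eq_mul, Real.norm_of_nonneg (hu0 _)]
    exact mul_le_mul_of_nonneg_left (hG n) (hu0 _)
  · refine (seminorm_sum_le _ _ _).trans (Finset.sum_le_sum fun i _ => ?_)
    have hi := neg_nonneg.2 (sub_nonpos.2 (hu (Nat.le_succ i)))
    rw [← neg_smul, map_smul_eq_mul, Real.norm_of_nonneg hi, ← neg_mul]
    exact mul_le_mul_of_nonneg_left (hG _) hi

lemma seminorm_sum_smul_le_of_antitone_of_bounded (hu : Antitone u) (hu0 : ∀ i, 0 ≤ u i) {C : ℝ}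
    (hG : ∀ n, p (∑ i ∈ Finset.range n, G i) ≤ C) (n : ℕ) :
    p (∑ i ∈ Finset.range n, u i • G i) ≤ u 0 * C := by
  have hC : 0 ≤ C := (apply_nonneg _ _).trans (hG 0)
  have hsum (n : ℕ) : ∑ i ∈ Finset.range (n + 1), (if i = 0 then C else 0) = C := by simp
  cases n with
  | zero => simpa using mul_nonneg (hu0 0) hC
  | succ n =>
    refine (seminorm_sum_smul_le_of_antitone p hu hu0 (g := fun i => if i = 0 then C else 0)
      (fun k => ?_) (n + 1)).trans_eq (by simp)
    cases k with
    | zero => simp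
    | succ k => simpa only [hsum] using hG (k + 1)

variable {α : ℝ}

lemma seminorm_sum_cesaroNumber_smul_le (hα₀ : 0 ≤ α) (hα₁ : α < 1) {C : ℝ}
    (hG : ∀ n, p (∑ i ∈ Finset.range n, G i) ≤ C * n) (n : ℕ) :
    p (∑ i ∈ Finset.range n, cesaroNumber (-α - 1) (i + 1) • G i) ≤ C := by
  have hC : 0 ≤ C := by simpa using (apply_nonneg _ _).trans (hG 1)
  calc p (∑ i ∈ Finset.range n, cesaroNumber (-α - 1) (i + 1) • G i)
      = p (∑ i ∈ Finset.range n, -cesaroNumber (-α - 1) (i + 1) • G i) := by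
        simp only [neg_smul, Finset.sum_neg_distrib, map_neg_eq_map]
    _ ≤ ∑ i ∈ Finset.range n, -cesaroNumber (-α - 1) (i + 1) * C :=
        seminorm_sum_smul_le_of_antitone p (neg_cesaroNumber_succ_antitone hα₀ hα₁)
          (neg_cesaroNumber_succ_nonneg hα₀ hα₁)
          (fun k => by simpa [mul_comm] using hG k) n
    _ ≤ C := by
        rw [← Finset.sum_mul]
        exact mul_le_of_le_one_left hC (sum_neg_cesaroNumber_succ_le_one hα₁ n)

lemma seminorm_sum_cesaroNumber_smul_le_of_bounded (hα₀ : 0 ≤ α) (hα₁ : α < 1) {C : ℝ}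
    (hG : ∀ n, p (∑ i ∈ Finset.range n, G i) ≤ C) (k n : ℕ) :
    p (∑ i ∈ Finset.range n, cesaroNumber (-α - 1) (k + i + 1) • G i) ≤
      ((k : ℝ) + 1) ^ (-1 - α) * C := by
  calc p (∑ i ∈ Finset.range n, cesaroNumber (-α - 1) (k + i + 1) • G i)
      = p (∑ i ∈ Finset.range n, -cesaroNumber (-α - 1) (k + i + 1) • G i) := by
        simp only [neg_smul, Finset.sum_neg_distrib, map_neg_eq_map]
    _ ≤ -cesaroNumber (-α - 1) (k + 1) * C :=
        seminorm_sum_smul_le_of_antitone_of_bounded p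
          (fun _ _ h => neg_cesaroNumber_succ_antitone hα₀ hα₁ (Nat.add_le_add_left h k))
          (fun _ => neg_cesaroNumber_succ_nonneg hα₀ hα₁ _) hG n
    _ ≤ ((k : ℝ) + 1) ^ (-1 - α) * C :=
        mul_le_mul_of_nonneg_right (neg_cesaroNumber_succ_le hα₀ hα₁ k)
          ((apply_nonneg _ _).trans (hG 0))

end AbelSummation

/-! ### Kernels with Cesàro weights -/

section CesaroKernels

/-- A constant for the `L¹` norms of the kernels `∑_{i ≤ L} A_i^{-α-1} D_{M_r - i} ⊗ D_{M_r - i}`;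
the summands come from the reflected form `D_{M_r} - ψ_{M_r - 1} · conj D_i` of `D_{M_r - i}`. -/
def upperKernelConst (B : ℕ) : ℝ := 1 + 2 * fejerConst B + marcinkiewiczConst B

variable {m : ℕ → ℕ} [∀ k, NeZero (m k)]

lemma dirichlet₂_zero : dirichlet₂ m 0 = 0 := by simp [dirichlet₂]

lemma dirichlet₂_reflect (hm : ∀ k, 2 ≤ m k) {r i : ℕ} (hi : i ≤ M m r) :
    dirichlet₂ m (M m r - i) = dirichlet₂ m (M m r) -
      tensor (dirichlet m (M m r)) (psiMap m (M m r - 1) * star (dirichlet m i)) -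
      tensor (psiMap m (M m r - 1) * star (dirichlet m i)) (dirichlet m (M m r)) +
      tensor (psiMap m (M m r - 1)) (psiMap m (M m r - 1)) * star (dirichlet₂ m i) := by
  have hstar : star (dirichlet₂ m i) = tensor (star (dirichlet m i)) (star (dirichlet m i)) := by
    ext z; simp [dirichlet₂]
  rw [hstar, tensor_mul_tensor, dirichlet₂, dirichlet_reflect hm hi, dirichlet₂]
  simp only [map_sub, LinearMap.sub_apply]
  abel

lemma sum_smul_dirichlet₂_reflect (hm : ∀ k, 2 ≤ m k) {r : ℕ} {s : Finset ℕ}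
    (hs : ∀ i ∈ s, i ≤ M m r) (w : ℕ → ℝ) :
    ∑ i ∈ s, w i • dirichlet₂ m (M m r - i) = (∑ i ∈ s, w i) • dirichlet₂ m (M m r) -
      tensor (dirichlet m (M m r)) (psiMap m (M m r - 1) * star (∑ i ∈ s, w i • dirichlet m i)) -
      tensor (psiMap m (M m r - 1) * star (∑ i ∈ s, w i • dirichlet m i)) (dirichlet m (M m r)) +
      tensor (psiMap m (M m r - 1)) (psiMap m (M m r - 1)) *
        star (∑ i ∈ s, w i • dirichlet₂ m i) := by
  rw [Finset.sum_congr rfl fun i hi => by rw [dirichlet₂_reflect hm (hs i hi)]]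
  simp only [smul_add, smul_sub, Finset.sum_add_distrib, Finset.sum_sub_distrib, Finset.sum_smul,
    star_sum, star_smul, star_trivial, Finset.mul_sum, mul_smul_comm, map_sum, map_smul,
    LinearMap.sum_apply, LinearMap.smul_apply]

variable {α : ℝ}

lemma l1Norm_sum_cesaroNumber_smul_dirichlet_le (hm : ∀ k, 2 ≤ m k) {B : ℕ} (hB : ∀ k, m k ≤ B)
    (hα₀ : 0 ≤ α) (hα₁ : α < 1) (L : ℕ) :
    l1Norm (haar m) (∑ i ∈ Finset.range (L + 1), cesaroNumber (-α - 1) i • dirichlet m i) ≤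
      fejerConst B := by
  rw [Finset.sum_range_succ', dirichlet_zero, smul_zero, add_zero]
  exact seminorm_sum_cesaroNumber_smul_le _ hα₀ hα₁ (l1Norm_fejer_le hm hB) L

lemma l1Norm_sum_cesaroNumber_smul_dirichlet₂_le (hm : ∀ k, 2 ≤ m k) {B : ℕ}
    (hB : ∀ k, m k ≤ B) (hα₀ : 0 ≤ α) (hα₁ : α < 1) (L : ℕ) :
    l1Norm (haar₂ m) (∑ i ∈ Finset.range (L + 1), cesaroNumber (-α - 1) i • dirichlet₂ m i) ≤
      marcinkiewiczConst B := by
  rw [Finset.sum_range_succ', dirichlet₂_zero, smul_zero, add_zero]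
  exact seminorm_sum_cesaroNumber_smul_le _ hα₀ hα₁ (l1Norm_marcinkiewicz_le hm hB) L

lemma l1Norm_sum_cesaroNumber_smul_dirichlet₂_sub_le (hm : ∀ k, 2 ≤ m k) {B : ℕ}
    (hB : ∀ k, m k ≤ B) (hα₀ : 0 ≤ α) (hα₁ : α < 1) {r L : ℕ} (hL : L ≤ M m r) :
    l1Norm (haar₂ m) (∑ i ∈ Finset.range (L + 1),
      cesaroNumber (-α - 1) i • dirichlet₂ m (M m r - i)) ≤ upperKernelConst B := by
  have hA : ‖∑ i ∈ Finset.range (L + 1), cesaroNumber (-α - 1) i‖ ≤ 1 := by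
    rw [sum_cesaroNumber, Real.norm_of_nonneg (cesaroNumber_neg_pos hα₁ L).le,
      ← cesaroNumber_zero (-α)]
    exact cesaroNumber_neg_antitone hα₀ hα₁ L.zero_le
  have hD := l1Norm_dirichlet_M hm r
  have hW := l1Norm_sum_cesaroNumber_smul_dirichlet_le hm hB hα₀ hα₁ L
  have hV := l1Norm_sum_cesaroNumber_smul_dirichlet₂_le hm hB hα₀ hα₁ L
  have hψ (K : C(Group m, ℂ)) : l1Norm (haar m) (psiMap m (M m r - 1) * K) = l1Norm (haar m) K :=
    l1Norm_mul_of_norm_eq_one (fun x => by simp [norm_psi]) K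
  have hψ₂ (K : C(Group m × Group m, ℂ)) : l1Norm (haar₂ m)
      (tensor (psiMap m (M m r - 1)) (psiMap m (M m r - 1)) * K) = l1Norm (haar₂ m) K :=
    l1Norm_mul_of_norm_eq_one (fun z => by simp [norm_psi]) K
  rw [sum_smul_dirichlet₂_reflect hm fun i hi => (Finset.mem_range_succ_iff.1 hi).trans hL]
  refine (map_add_le_add _ _ _).trans (add_le_add_left ((map_sub_le_add _ _ _).trans
    (add_le_add_left (map_sub_le_add _ _ _) _)) _ |>.trans ?_)
  rw [map_smul_eq_mul, dirichlet₂, l1Norm_haar₂_tensor, l1Norm_haar₂_tensor, l1Norm_haar₂_tensor,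
    hψ, hψ₂, l1Norm_star, l1Norm_star, hD]
  unfold upperKernelConst
  linarith

lemma sum_dirichlet₂_sub (b n : ℕ) :
    ∑ i ∈ Finset.range n, dirichlet₂ m (b - i) = marcinkiewicz m b - marcinkiewicz m (b - n) := by
  induction n with
  | zero => simp
  | succ n ih =>
    rw [Finset.sum_range_succ, ih]
    rcases Nat.lt_or_ge n b with h | h
    · rw [show b - n = b - (n + 1) + 1 by omega, marcinkiewicz, marcinkiewicz, marcinkiewicz,
        Finset.sum_range_succ _ (b - (n + 1))]
      abel
    · rw [Nat.sub_eq_zero_of_le h, Nat.sub_eq_zero_of_le (h.trans n.le_succ), dirichlet₂_zero,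
        add_zero]

lemma l1Norm_sum_dirichlet₂_sub_le (hm : ∀ k, 2 ≤ m k) {B : ℕ} (hB : ∀ k, m k ≤ B) (b n : ℕ) :
    l1Norm (haar₂ m) (∑ i ∈ Finset.range n, dirichlet₂ m (b - i)) ≤
      2 * marcinkiewiczConst B * b := by
  have hC := marcinkiewiczConst_nonneg B
  have hsub : ((b - n : ℕ) : ℝ) ≤ b := Nat.cast_le.2 (Nat.sub_le b n)
  calc _ ≤ marcinkiewiczConst B * b + marcinkiewiczConst B * (b - n : ℕ) := by
        rw [sum_dirichlet₂_sub]
        exact (map_sub_le_add _ _ _).trans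
          (add_le_add (l1Norm_marcinkiewicz_le hm hB b) (l1Norm_marcinkiewicz_le hm hB _))
    _ ≤ 2 * marcinkiewiczConst B * b := by linarith [mul_le_mul_of_nonneg_left hsub hC]

lemma sum_Ico_smul_dirichlet₂_eq (w : ℕ → ℝ) {a b N : ℕ} (hb : b ≤ N + 1) :
    ∑ j ∈ Finset.Ico a b, w (N - j) • dirichlet₂ m j =
      ∑ i ∈ Finset.range (b - a), w (N + 1 - b + i) • dirichlet₂ m (b - 1 - i) := by
  rw [Finset.sum_Ico_eq_sum_range, ← Finset.sum_range_reflect]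
  refine Finset.sum_congr rfl fun i hi => ?_
  have := Finset.mem_range.1 hi
  rw [show a + (b - a - 1 - i) = b - 1 - i by omega, show N - (b - 1 - i) = N + 1 - b + i by omega]

lemma l1Norm_upperKernel_le (hm : ∀ k, 2 ≤ m k) {B : ℕ} (hB : ∀ k, m k ≤ B) (hα₀ : 0 ≤ α)
    (hα₁ : α < 1) (n : ℕ) :
    l1Norm (haar₂ m) (∑ j ∈ Finset.Ico (M m n) (M m (n + 1) + 1),
      cesaroNumber (-α - 1) (M m (n + 1) - j) • dirichlet₂ m j) ≤ upperKernelConst B := by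
  rw [sum_Ico_smul_dirichlet₂_eq _ le_rfl, Nat.sub_self,
    Nat.sub_add_comm (M_mono (Nat.le_succ n) : M m n ≤ M m (n + 1))]
  simpa only [zero_add, Nat.add_sub_cancel] using
    l1Norm_sum_cesaroNumber_smul_dirichlet₂_sub_le hm hB hα₀ hα₁
      (Nat.sub_le (M m (n + 1)) (M m n))

lemma rpow_neg_one_sub_le (hα₀ : -1 ≤ α) (hα₁ : α ≤ 1) {x y : ℝ} (hx : 0 < x) (hxy : x ≤ 2 * y) :
    y ^ (-1 - α) ≤ 4 * x ^ (-1 - α) := by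
  calc y ^ (-1 - α) ≤ (x / 2) ^ (-1 - α) :=
        Real.rpow_le_rpow_of_nonpos (by positivity) (by linarith) (by linarith)
    _ = 2 ^ (1 + α) * x ^ (-1 - α) := by
        rw [Real.div_rpow hx.le two_pos.le, div_eq_inv_mul, ← Real.rpow_neg two_pos.le]
        ring_nf
    _ ≤ 2 ^ (2 : ℝ) * x ^ (-1 - α) := by
        gcongr
        · exact one_le_two
        · linarith
    _ = 4 * x ^ (-1 - α) := by norm_num

lemma l1Norm_lowerKernel_le (hm : ∀ k, 2 ≤ m k) {B : ℕ} (hB : ∀ k, m k ≤ B) (hα₀ : 0 ≤ α)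
    (hα₁ : α < 1) {r n : ℕ} (hr : r < n) :
    l1Norm (haar₂ m) (∑ j ∈ Finset.Ico (M m r) (M m (r + 1)),
      cesaroNumber (-α - 1) (M m (n + 1) - j) • dirichlet₂ m j) ≤
      8 * marcinkiewiczConst B * B * (M m r * (M m (n + 1) : ℝ) ^ (-1 - α)) := by
  set N := M m (n + 1)
  set b := M m (r + 1)
  have hbN : 2 * b ≤ N := Nat.mul_le_mul (hm n) (M_mono (Nat.succ_le_of_lt hr))
  have hhalf : (N : ℝ) ≤ 2 * ((N - b : ℕ) + 1) := by exact_mod_cast (by omega)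
  have hb : ((b - 1 : ℕ) : ℝ) ≤ B * M m r := by
    exact_mod_cast (Nat.sub_le _ _).trans (Nat.mul_le_mul_right _ (hB r))
  have hC := marcinkiewiczConst_nonneg B
  rw [sum_Ico_smul_dirichlet₂_eq _ (by omega), Nat.sub_add_comm (by omega : b ≤ N)]
  simp only [add_right_comm (N - b) 1]
  calc _ ≤ (((N - b : ℕ) : ℝ) + 1) ^ (-1 - α) * (2 * marcinkiewiczConst B * (b - 1 : ℕ)) :=
        seminorm_sum_cesaroNumber_smul_le_of_bounded _ hα₀ hα₁
          (l1Norm_sum_dirichlet₂_sub_le hm hB (b - 1)) _ _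
    _ ≤ 4 * (N : ℝ) ^ (-1 - α) * (2 * marcinkiewiczConst B * (B * M m r)) := by
        gcongr
        exact rpow_neg_one_sub_le (by linarith) hα₁.le (Nat.cast_pos.2 (M_pos _)) hhalf
    _ = _ := by ring

end CesaroKernels

/-! ### Integral operators on `L^p` -/

section IntegralOperators

variable {X Y E : Type*} [MeasurableSpace X] [MeasurableSpace Y] [NormedAddCommGroup E]
  {μ : Measure X} {ν : Measure Y} {k : Y → ℝ≥0∞}

lemma lintegral_mul_enorm_rpow_le (hk : Measurable k) (hk' : ∀ y, k y < ∞) {g : Y → E}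
    (hg : AEStronglyMeasurable g ν) {q : ℝ} (hq : 1 ≤ q) :
    (∫⁻ y, k y * ‖g y‖ₑ ∂ν) ^ q ≤ (∫⁻ y, k y * ‖g y‖ₑ ^ q ∂ν) * (∫⁻ y, k y ∂ν) ^ (q - 1) := by
  have hq0 : 0 < q := one_pos.trans_le hq
  have hdens := lintegral_withDensity_eq_lintegral_mul_non_measurable ν hk
    (Filter.Eventually.of_forall hk')
  have h := eLpNorm_le_eLpNorm_mul_rpow_measure_univ (p := 1) (q := ENNReal.ofReal q)
    (by simpa using ENNReal.ofReal_le_ofReal hq)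
    (hg.mono_ac (withDensity_absolutelyContinuous ν k))
  rw [eLpNorm_one_eq_lintegral_enorm, eLpNorm_eq_lintegral_rpow_enorm_toReal (by simpa using hq0)
    ENNReal.ofReal_ne_top, ENNReal.toReal_ofReal hq0.le, hdens, hdens,
    withDensity_apply _ MeasurableSet.univ, Measure.restrict_univ] at h
  have hexp : (1 / ENNReal.toReal 1 - 1 / q) * q = q - 1 := by
    rw [ENNReal.toReal_one, sub_mul, one_div_mul_cancel hq0.ne', one_div_one, one_mul]
  simpa only [Pi.mul_apply, ENNReal.mul_rpow_of_nonneg _ _ hq0.le, ← ENNReal.rpow_mul, hexp,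
    one_div_mul_cancel hq0.ne', ENNReal.rpow_one] using
    ENNReal.rpow_le_rpow h hq0.le

lemma enorm_integral_mul_le {K g : Y → ℂ} (hK : Measurable K) {C : ℝ≥0∞}
    (hC : ∀ y, K y ≠ 0 → ‖g y‖ₑ ≤ C) : ‖∫ y, K y * g y ∂ν‖ₑ ≤ (∫⁻ y, ‖K y‖ₑ ∂ν) * C := by
  refine (enorm_integral_le_lintegral_enorm _).trans ?_
  rw [← lintegral_mul_const _ hK.enorm]
  gcongr with y
  rw [enorm_mul]
  by_cases h : K y = 0
  · simp [h]
  · gcongr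
    exact hC y h

variable [SFinite μ] [SFinite ν]

lemma lintegral_lintegral_mul_enorm_rpow_le (hk : Measurable k) (hk' : ∀ y, k y < ∞)
    (hk'' : ∫⁻ y, k y ∂ν ≠ ∞) {g : X → Y → E}
    (hg : AEStronglyMeasurable (Function.uncurry g) (μ.prod ν)) {q : ℝ} (hq : 1 ≤ q) {C : ℝ≥0∞}
    (hC : ∀ y, k y ≠ 0 → ∫⁻ x, ‖g x y‖ₑ ^ q ∂μ ≤ C ^ q) :
    ∫⁻ x, (∫⁻ y, k y * ‖g x y‖ₑ ∂ν) ^ q ∂μ ≤ ((∫⁻ y, k y ∂ν) * C) ^ q := by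
  have hq0 : 0 < q := one_pos.trans_le hq
  set κ := ∫⁻ y, k y ∂ν with hκ
  calc ∫⁻ x, (∫⁻ y, k y * ‖g x y‖ₑ ∂ν) ^ q ∂μ
      ≤ ∫⁻ x, (∫⁻ y, k y * ‖g x y‖ₑ ^ q ∂ν) * κ ^ (q - 1) ∂μ := by
        refine lintegral_mono_ae ?_
        filter_upwards [hg.prodMk_left] with x hx
        exact lintegral_mul_enorm_rpow_le hk hk' hx hq
    _ = (∫⁻ x, ∫⁻ y, k y * ‖g x y‖ₑ ^ q ∂ν ∂μ) * κ ^ (q - 1) :=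
        lintegral_mul_const' _ _ (ENNReal.rpow_ne_top_of_nonneg (sub_nonneg.2 hq) hk'')
    _ = (∫⁻ y, ∫⁻ x, k y * ‖g x y‖ₑ ^ q ∂μ ∂ν) * κ ^ (q - 1) := by
        rw [lintegral_lintegral_swap]
        exact (hk.comp measurable_snd).aemeasurable.mul (hg.enorm.pow_const q)
    _ ≤ (∫⁻ y, k y * C ^ q ∂ν) * κ ^ (q - 1) := by
        gcongr with y
        rw [lintegral_const_mul' _ _ (hk' y).ne]
        by_cases h : k y = 0
        · simp [h]
        · gcongr
          exact hC y h
    _ = (κ * C) ^ q := by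
        rw [lintegral_mul_const _ hk, ← hκ, ENNReal.mul_rpow_of_nonneg _ _ hq0.le, mul_right_comm]
        nth_rewrite 1 [← ENNReal.rpow_one κ]
        rw [← ENNReal.rpow_add_of_nonneg _ _ one_pos.le (sub_nonneg.2 hq), add_sub_cancel]

lemma eLpNorm_integral_mul_le {K : Y → ℂ} (hK : Measurable K) (hK' : Integrable K ν)
    {g : X → Y → ℂ} (hg : AEStronglyMeasurable (Function.uncurry g) (μ.prod ν)) {p : ℝ≥0∞}
    (hp : 1 ≤ p) (hp' : p ≠ ∞) {C : ℝ≥0∞} (hC : ∀ y, K y ≠ 0 → eLpNorm (fun x => g x y) p μ ≤ C) :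
    eLpNorm (fun x => ∫ y, K y * g x y ∂ν) p μ ≤ (∫⁻ y, ‖K y‖ₑ ∂ν) * C := by
  have hp0 : p ≠ 0 := (one_pos.trans_le hp).ne'
  have hq : 1 ≤ p.toReal := by simpa using ENNReal.toReal_mono hp' hp
  have hq0 : 0 < p.toReal := one_pos.trans_le hq
  simp only [eLpNorm_eq_lintegral_rpow_enorm_toReal hp0 hp', one_div,
    ENNReal.rpow_inv_le_iff hq0] at hC ⊢
  calc ∫⁻ x, ‖∫ y, K y * g x y ∂ν‖ₑ ^ p.toReal ∂μ
      ≤ ∫⁻ x, (∫⁻ y, ‖K y‖ₑ * ‖g x y‖ₑ ∂ν) ^ p.toReal ∂μ := by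
        gcongr with x
        simpa only [enorm_mul] using enorm_integral_le_lintegral_enorm fun y => K y * g x y
    _ ≤ ((∫⁻ y, ‖K y‖ₑ ∂ν) * C) ^ p.toReal :=
        lintegral_lintegral_mul_enorm_rpow_le hK.enorm (fun _ => enorm_lt_top) hK'.2.ne hg hq
          fun y hy => hC y (enorm_ne_zero.1 hy)

end IntegralOperators

/-! ### The spaces `L^p(G_m × G_m)` -/

section Lp

variable {m : ℕ → ℕ} [∀ k, NeZero (m k)] {p : ℝ≥0∞} {f g : Group m × Group m → ℂ}

lemma InLp.of_continuous (hf : Continuous f) : InLp m p f := by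
  unfold InLp
  split_ifs
  · exact hf
  · exact hf.memLp_of_hasCompactSupport (HasCompactSupport.of_compactSpace _)

lemma InLp.memLp (hf : InLp m p f) : MemLp f p (haar₂ m) := by
  unfold InLp at hf
  split_ifs at hf
  · exact hf.memLp_of_hasCompactSupport (HasCompactSupport.of_compactSpace _)
  · exact hf

lemma InLp.integrable (hp : 1 ≤ p) (hf : InLp m p f) : Integrable f (haar₂ m) :=
  hf.memLp.integrable hp

/-- The space `L^p(G_m × G_m)` as a space of functions (not of almost everywhere classes). -/
def lpSubmodule (m : ℕ → ℕ) [∀ k, NeZero (m k)] (p : ℝ≥0∞) :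
    Submodule ℂ (Group m × Group m → ℂ) where
  carrier := {f | InLp m p f}
  zero_mem' := InLp.of_continuous continuous_const
  add_mem' hf hg := by
    simp only [Set.mem_ofPred_eq, InLp] at *
    split_ifs at *
    · exact hf.add hg
    · exact hf.add hg
  smul_mem' c _ hf := by
    simp only [Set.mem_ofPred_eq, InLp] at *
    split_ifs at *
    · exact hf.const_smul c
    · exact hf.const_smul c

lemma InLp.sub (hf : InLp m p f) (hg : InLp m p g) : InLp m p (f - g) :=
  (lpSubmodule m p).sub_mem hf hg

lemma InLp.smul (hf : InLp m p f) (c : ℝ) : InLp m p (c • f) :=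
  (lpSubmodule m p).smul_of_tower_mem c hf

lemma InLp.sum {ι : Type*} (s : Finset ι) {F : ι → Group m × Group m → ℂ}
    (hF : ∀ i ∈ s, InLp m p (F i)) : InLp m p (∑ i ∈ s, F i) :=
  (lpSubmodule m p).sum_mem hF

lemma InLp.comp_add_right (hf : InLp m p f) (a : Group m × Group m) :
    InLp m p fun z => f (z + a) := by
  unfold InLp at *
  split_ifs at *
  · exact hf.comp (continuous_id.add continuous_const)
  · exact hf.comp_measurePreserving (measurePreserving_add_right _ a)

lemma normLp_add_le (hp : 1 ≤ p) (hf : InLp m p f) (hg : InLp m p g) :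
    normLp m p (f + g) ≤ normLp m p f + normLp m p g := by
  unfold normLp
  split_ifs
  · exact iSup_le fun z => (enorm_add_le _ _).trans
      (add_le_add (le_iSup (fun z => ‖f z‖ₑ) z) (le_iSup (fun z => ‖g z‖ₑ) z))
  · exact eLpNorm_add_le hf.memLp.1 hg.memLp.1 hp

lemma normLp_neg : normLp m p (-f) = normLp m p f := by simp [normLp]

lemma normLp_sub_le (hp : 1 ≤ p) (hf : InLp m p f) (hg : InLp m p g) :
    normLp m p (f - g) ≤ normLp m p f + normLp m p g := by
  simpa only [sub_eq_add_neg, normLp_neg] using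
    normLp_add_le hp hf ((lpSubmodule m p).neg_mem hg)

lemma normLp_smul_le (c : ℝ) : normLp m p (c • f) ≤ ‖c‖ₑ * normLp m p f := by
  unfold normLp
  split_ifs
  · refine iSup_le fun z => ?_
    rw [Pi.smul_apply, enorm_smul]
    gcongr
    exact le_iSup (fun z => ‖f z‖ₑ) z
  · exact eLpNorm_const_smul_le

lemma normLp_sum_le (hp : 1 ≤ p) {ι : Type*} (s : Finset ι) {F : ι → Group m × Group m → ℂ}
    (hF : ∀ i ∈ s, InLp m p (F i)) :
    normLp m p (∑ i ∈ s, F i) ≤ ∑ i ∈ s, normLp m p (F i) :=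
  Finset.le_sum_of_subadditive_on_pred (normLp m p) (InLp m p) (by simp [normLp])
    (fun _ _ => normLp_add_le hp) (fun _ _ => (lpSubmodule m p).add_mem) F hF

lemma normLp_comp_add_right (hf : InLp m p f) (a : Group m × Group m) :
    normLp m p (fun z => f (z + a)) = normLp m p f := by
  unfold normLp
  split_ifs
  · exact (Equiv.addRight a).iSup_congr fun z => rfl
  · exact eLpNorm_comp_measurePreserving hf.memLp.1 (measurePreserving_add_right _ a)

lemma normLp_integral_star_mul_le (hp : 1 ≤ p) (K : C(Group m × Group m, ℂ))
    {g : Group m × Group m → Group m × Group m → ℂ}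
    (hg : AEStronglyMeasurable (Function.uncurry g) ((haar₂ m).prod (haar₂ m))) {C : ℝ≥0∞}
    (hC : ∀ t, K t ≠ 0 → normLp m p (fun z => g z t) ≤ C) :
    normLp m p (fun z => ∫ t, star (K t) * g z t ∂haar₂ m) ≤
      ENNReal.ofReal (l1Norm (haar₂ m) K) * C := by
  have hK : Continuous fun t => star (K t) := by fun_prop
  have hl1 : ∫⁻ t, ‖star (K t)‖ₑ ∂haar₂ m = ENNReal.ofReal (l1Norm (haar₂ m) K) := by
    rw [← l1Norm_star]
    exact (ofReal_integral_norm_eq_lintegral_enorm (integrable_of_continuous _ hK)).symm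
  rw [← hl1]
  unfold normLp at *
  split_ifs at * with h
  · exact iSup_le fun z => enorm_integral_mul_le hK.measurable fun t ht =>
      (le_iSup (fun z => ‖g z t‖ₑ) z).trans (hC t (star_ne_zero.1 ht))
  · exact eLpNorm_integral_mul_le hK.measurable (integrable_of_continuous _ hK) hg hp h
      fun t ht => hC t (star_ne_zero.1 ht)

lemma aestronglyMeasurable_comp_add (hf : AEStronglyMeasurable f (haar₂ m)) :
    AEStronglyMeasurable (Function.uncurry fun z t => f (z + t)) ((haar₂ m).prod (haar₂ m)) :=
  hf.comp_quasiMeasurePreserving <| Measure.quasiMeasurePreserving_snd.comp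
    (measurePreserving_prod_add (haar₂ m) (haar₂ m)).quasiMeasurePreserving

end Lp

/-! ### Correlation with a kernel -/

section Correlation

variable {m : ℕ → ℕ} [∀ k, NeZero (m k)] {p : ℝ≥0∞} {f g : Group m × Group m → ℂ}

/-- The average of the translates `f (· + t)` against the conjugate of the kernel `K`. This is
convolution with `t ↦ conj (K (-t))`; for Dirichlet kernels, it is convolution with `K` itself. -/
def correlation (K : C(Group m × Group m, ℂ)) (f : Group m × Group m → ℂ)
    (z : Group m × Group m) : ℂ :=
  ∫ t, star (K t) * f (z + t) ∂haar₂ m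

lemma integrable_star_mul_comp_add (K : C(Group m × Group m, ℂ)) (hf : Integrable f (haar₂ m))
    (z : Group m × Group m) : Integrable (fun t => star (K t) * f (z + t)) (haar₂ m) :=
  (hf.comp_add_left z).bdd_mul (c := ‖K‖) (by fun_prop)
    (Filter.Eventually.of_forall fun t => by simpa using K.norm_coe_le_norm t)

lemma normLp_correlation_le (hp : 1 ≤ p) (K : C(Group m × Group m, ℂ)) (hf : InLp m p f) :
    normLp m p (correlation K f) ≤ ENNReal.ofReal (l1Norm (haar₂ m) K) * normLp m p f :=
  normLp_integral_star_mul_le hp K (aestronglyMeasurable_comp_add hf.memLp.1) fun t _ =>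
    (normLp_comp_add_right hf t).le

lemma correlation_smul (c : ℝ) (K : C(Group m × Group m, ℂ)) (f : Group m × Group m → ℂ) :
    correlation (c • K) f = c • correlation K f := by
  ext z
  simp [correlation, mul_assoc, integral_const_mul]

lemma correlation_sum {ι : Type*} (s : Finset ι) (K : ι → C(Group m × Group m, ℂ))
    (hf : Integrable f (haar₂ m)) :
    correlation (∑ i ∈ s, K i) f = ∑ i ∈ s, correlation (K i) f := by
  ext z
  simp only [correlation, ContinuousMap.sum_apply, star_sum, Finset.sum_mul, Finset.sum_apply]
  exact integral_finsetSum _ fun i _ => integrable_star_mul_comp_add (K i) hf z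

lemma correlation_sub (K : C(Group m × Group m, ℂ)) (hf : Integrable f (haar₂ m))
    (hg : Integrable g (haar₂ m)) : correlation K (f - g) = correlation K f - correlation K g := by
  ext z
  simp only [correlation, Pi.sub_apply, mul_sub]
  exact integral_sub (integrable_star_mul_comp_add K hf z) (integrable_star_mul_comp_add K hg z)

end Correlation

/-! ### Quadratic partial sums -/

section PartialSums

variable {m : ℕ → ℕ} [∀ k, NeZero (m k)] {f : Group m × Group m → ℂ}

lemma continuous_partialSum (a b : ℕ) (f : Group m × Group m → ℂ) :
    Continuous (partialSum m a b f) := by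
  have h (n : ℕ) : Continuous (psi m n) := (psiMap m n).continuous.congr (psiMap_apply n)
  unfold partialSum; fun_prop

lemma integrable_partialSum (a b : ℕ) (f : Group m × Group m → ℂ) :
    Integrable (partialSum m a b f) (haar₂ m) :=
  integrable_of_continuous _ (continuous_partialSum a b f)

lemma correlation_tensor_psiMap (a b : ℕ) (f : Group m × Group m → ℂ) (z : Group m × Group m) :
    correlation (tensor (psiMap m a) (psiMap m b)) f z =
      fourierCoeff m f a b * psi m a z.1 * psi m b z.2 := by
  rw [fourierCoeff, ← integral_add_left_eq_self _ z, ← integral_mul_const, ← integral_mul_const]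
  refine integral_congr_ae (Filter.Eventually.of_forall fun t => ?_)
  simp only [tensor_apply, psiMap_apply, Prod.fst_add, Prod.snd_add, psi_add, map_mul,
    ← starRingEnd_apply]
  linear_combination -starRingEnd ℂ (psi m a t.1) * starRingEnd ℂ (psi m b t.2) * f (z + t) *
    (psi m a z.1 * starRingEnd ℂ (psi m a z.1) * psi_mul_conj b z.2 + psi_mul_conj a z.1)

lemma partialSum_eq_correlation (hf : Integrable f (haar₂ m)) (n : ℕ) :
    partialSum m n n f = correlation (dirichlet₂ m n) f := by
  have hD : dirichlet₂ m n = ∑ a ∈ Finset.range n, ∑ b ∈ Finset.range n,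
      tensor (psiMap m a) (psiMap m b) := by
    simp only [dirichlet₂, dirichlet, map_sum, LinearMap.sum_apply]
    exact Finset.sum_comm
  ext z
  simp only [hD, correlation_sum _ _ hf, Finset.sum_apply, correlation_tensor_psiMap, partialSum]

lemma fourierCoeff_sum_mul {ι : Type*} (s : Finset ι) (c : ι → ℂ)
    (K : ι → C(Group m × Group m, ℂ)) (a b : ℕ) :
    fourierCoeff m (fun z => ∑ i ∈ s, c i * K i z) a b =
      ∑ i ∈ s, c i * fourierCoeff m (K i) a b := by
  simp only [fourierCoeff, ← psiMap_apply, Finset.sum_mul, ← integral_const_mul, ← mul_assoc]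
  exact integral_finsetSum _ fun i _ => integrable_of_continuous _ (by fun_prop)

lemma fourierCoeff_tensor_psiMap (hm : ∀ k, 2 ≤ m k) (a b a' b' : ℕ) :
    fourierCoeff m (tensor (psiMap m a) (psiMap m b)) a' b' =
      (if a = a' then 1 else 0) * if b = b' then 1 else 0 := by
  rw [← integral_psi_mul_conj hm, ← integral_psi_mul_conj hm, ← integral_prod_mul]
  refine integral_congr_ae (Filter.Eventually.of_forall fun z => ?_)
  simp only [tensor_apply, psiMap_apply]
  ring

lemma fourierCoeff_partialSum (hm : ∀ k, 2 ≤ m k) (n a b : ℕ) (f : Group m × Group m → ℂ) :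
    fourierCoeff m (partialSum m n n f) a b =
      if a < n ∧ b < n then fourierCoeff m f a b else 0 := by
  have h : partialSum m n n f = fun z => ∑ i ∈ Finset.range n ×ˢ Finset.range n,
      fourierCoeff m f i.1 i.2 * tensor (psiMap m i.1) (psiMap m i.2) z := by
    ext z
    simp only [partialSum, Finset.sum_product, tensor_apply, psiMap_apply, mul_assoc]
  rw [h, fourierCoeff_sum_mul, Finset.sum_product]
  simp only [fourierCoeff_tensor_psiMap hm]
  by_cases ha : a < n <;> by_cases hb : b < n <;> simp [ha, hb]

lemma partialSum_partialSum (hm : ∀ k, 2 ≤ m k) {n j : ℕ} (hj : n ≤ j)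
    (f : Group m × Group m → ℂ) :
    partialSum m j j (partialSum m n n f) = partialSum m n n f := by
  have hsub := Finset.range_mono hj
  ext z
  simp only [partialSum.eq_def m j, fourierCoeff_partialSum hm]
  rw [partialSum, ← Finset.sum_subset hsub]
  · refine Finset.sum_congr rfl fun a ha => ?_
    rw [← Finset.sum_subset hsub]
    · exact Finset.sum_congr rfl fun b hb => by
        rw [if_pos ⟨Finset.mem_range.1 ha, Finset.mem_range.1 hb⟩]
    · intro b _ hb
      simp [Finset.mem_range.not.1 hb]
  · intro a _ ha
    simp [Finset.mem_range.not.1 ha]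

lemma partialSum_sub_self (hm : ∀ k, 2 ≤ m k) {n j : ℕ} (hj : n ≤ j)
    (hf : Integrable f (haar₂ m)) :
    partialSum m j j f - f = (partialSum m n n f - f) -
      correlation (dirichlet₂ m j) (partialSum m n n f - f) := by
  have hS := integrable_partialSum n n f
  rw [correlation_sub _ hS hf, ← partialSum_eq_correlation hS, ← partialSum_eq_correlation hf,
    partialSum_partialSum hm hj]
  abel

lemma integral_dirichlet₂ (hm : ∀ k, 2 ≤ m k) {n : ℕ} (hn : 0 < n) :
    ∫ z, dirichlet₂ m n z ∂haar₂ m = 1 := by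
  simp only [dirichlet₂, tensor_apply]
  exact (integral_prod_mul (μ := haar m) (ν := haar m) (dirichlet m n) (dirichlet m n)).trans
    (by rw [integral_dirichlet hm hn, mul_one])

lemma dirichlet₂_M_eq_zero (hm : ∀ k, 2 ≤ m k) {n : ℕ} {z : Group m × Group m}
    (hz : ¬(z.1 ∈ cyl m n ∧ z.2 ∈ cyl m n)) : dirichlet₂ m (M m n) z = 0 := by
  rw [not_and_or] at hz
  rcases hz with h | h <;> simp [dirichlet₂, dirichlet_M_apply hm, h]

end PartialSums

/-! ### Approximation by partial sums and Cesàro means -/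

section Approximation

variable {m : ℕ → ℕ} [∀ k, NeZero (m k)] {p : ℝ≥0∞} {f : Group m × Group m → ℂ}

lemma normLp_translate_sub_le (hp : 1 ≤ p) (hf : InLp m p f) {n : ℕ} {u v : Group m}
    (hu : u ∈ cyl m n) (hv : v ∈ cyl m n) :
    normLp m p (fun z => f (z + (u, v)) - f z) ≤ modulus₁ m p f n + modulus₂ m p f n := by
  have hadd₁ (z : Group m × Group m) : z + (u, 0) = (z.1 + u, z.2) := by ext <;> simp
  have hadd₂ (z : Group m × Group m) : z + (0, v) = (z.1, z.2 + v) := by ext <;> simp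
  set g₁ := fun z => f (z + (u, 0)) - f z with hg₁
  set g₂ := fun z => f (z + (0, v)) - f z with hg₂
  have h₁ : InLp m p g₁ := (hf.comp_add_right (u, 0)).sub hf
  have h₂ : InLp m p g₂ := (hf.comp_add_right (0, v)).sub hf
  have hsplit : (fun z => f (z + (u, v)) - f z) = g₁ + fun z => g₂ (z + (u, 0)) := by
    ext z
    simp [hg₁, hg₂, add_assoc]
  rw [hsplit]
  refine (normLp_add_le hp h₁ (h₂.comp_add_right _)).trans (add_le_add ?_ ?_)
  · simp only [hg₁, hadd₁]
    exact le_iSup₂ (f := fun u (_ : u ∈ cyl m n) =>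
      normLp m p fun z => f (z.1 + u, z.2) - f z) u hu
  · rw [normLp_comp_add_right h₂]
    simp only [hg₂, hadd₂]
    exact le_iSup₂ (f := fun v (_ : v ∈ cyl m n) =>
      normLp m p fun z => f (z.1, z.2 + v) - f z) v hv

lemma normLp_partialSum_M_sub_le (hm : ∀ k, 2 ≤ m k) (hp : 1 ≤ p) (hf : InLp m p f) (n : ℕ) :
    normLp m p (partialSum m (M m n) (M m n) f - f) ≤ modulus₁ m p f n + modulus₂ m p f n := by
  set K := dirichlet₂ m (M m n)
  have hint := hf.integrable hp
  have hK : ∫ t, star (K t) ∂haar₂ m = 1 :=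
    integral_conj.trans (by rw [integral_dirichlet₂ hm (M_pos n), map_one])
  have hl1 : l1Norm (haar₂ m) K = 1 :=
    (l1Norm_haar₂_tensor _ _).trans (by rw [l1Norm_dirichlet_M hm, one_mul])
  have havg : partialSum m (M m n) (M m n) f - f =
      fun z => ∫ t, star (K t) * (f (z + t) - f z) ∂haar₂ m := by
    ext z
    simp only [mul_sub]
    rw [integral_sub (integrable_star_mul_comp_add K hint z)
      (integrable_of_continuous _ (by fun_prop)), integral_mul_const, hK, one_mul, Pi.sub_apply,
      partialSum_eq_correlation hint, correlation]
  rw [havg, ← one_mul (_ + _), ← ENNReal.ofReal_one, ← hl1]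
  refine normLp_integral_star_mul_le hp K (g := fun z t => f (z + t) - f z)
    ((aestronglyMeasurable_comp_add hf.memLp.1).sub hf.memLp.1.comp_fst) fun t ht => ?_
  obtain ⟨hu, hv⟩ := not_imp_comm.1 (dirichlet₂_M_eq_zero hm) ht
  exact normLp_translate_sub_le hp hf hu hv

lemma norm_sum_le_l1Norm_sum_smul_dirichlet₂ (hm : ∀ k, 2 ≤ m k) {s : Finset ℕ}
    (hs : ∀ j ∈ s, 0 < j) (w : ℕ → ℝ) :
    ‖∑ j ∈ s, w j‖ ≤ l1Norm (haar₂ m) (∑ j ∈ s, w j • dirichlet₂ m j) := by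
  have hint : ∫ z, (∑ j ∈ s, w j • dirichlet₂ m j) z ∂haar₂ m = (∑ j ∈ s, w j : ℝ) := by
    simp only [ContinuousMap.sum_apply, ContinuousMap.smul_apply, Complex.ofReal_sum]
    rw [integral_finsetSum _ fun j _ => integrable_of_continuous _ (by fun_prop)]
    refine Finset.sum_congr rfl fun j hj => ?_
    rw [integral_smul, integral_dirichlet₂ hm (hs j hj), Complex.real_smul, mul_one]
  rw [← Complex.norm_real, ← hint]
  exact norm_integral_le_integral_norm _

lemma normLp_sum_smul_partialSum_sub_le (hm : ∀ k, 2 ≤ m k) (hp : 1 ≤ p) (hf : InLp m p f) {r : ℕ}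
    {s : Finset ℕ} (hs : ∀ j ∈ s, M m r ≤ j) (w : ℕ → ℝ) :
    normLp m p (∑ j ∈ s, w j • (partialSum m j j f - f)) ≤
      2 * (ENNReal.ofReal (l1Norm (haar₂ m) (∑ j ∈ s, w j • dirichlet₂ m j)) *
        (modulus₁ m p f r + modulus₂ m p f r)) := by
  set K := ∑ j ∈ s, w j • dirichlet₂ m j with hK
  set h := partialSum m (M m r) (M m r) f - f
  have hh : InLp m p h := (InLp.of_continuous (continuous_partialSum _ _ f)).sub hf
  have hω : normLp m p h ≤ modulus₁ m p f r + modulus₂ m p f r :=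
    normLp_partialSum_M_sub_le hm hp hf r
  have hcorr : InLp m p (correlation K h) := by
    rw [hK, correlation_sum _ _ (hh.integrable hp)]
    refine InLp.sum _ fun j _ => ?_
    rw [correlation_smul, ← partialSum_eq_correlation (hh.integrable hp)]
    exact (InLp.of_continuous (continuous_partialSum _ _ h)).smul _
  have hsum : ∑ j ∈ s, w j • (partialSum m j j f - f) = (∑ j ∈ s, w j) • h - correlation K h := by
    rw [hK, correlation_sum _ _ (hh.integrable hp), Finset.sum_smul, ← Finset.sum_sub_distrib]
    exact Finset.sum_congr rfl fun j hj => by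
      rw [partialSum_sub_self hm (hs j hj) (hf.integrable hp), smul_sub, correlation_smul]
  have hw : ‖∑ j ∈ s, w j‖ₑ ≤ ENNReal.ofReal (l1Norm (haar₂ m) K) := by
    rw [← ofReal_norm]
    exact ENNReal.ofReal_le_ofReal
      (norm_sum_le_l1Norm_sum_smul_dirichlet₂ hm (fun j hj => (M_pos r).trans_le (hs j hj)) w)
  rw [hsum, two_mul]
  refine (normLp_sub_le hp (hh.smul _) hcorr).trans (add_le_add ?_ ?_)
  · exact (normLp_smul_le _).trans (mul_le_mul' hw hω)
  · exact (normLp_correlation_le hp K hh).trans (by gcongr)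

lemma normLp_smul_block_le (hm : ∀ k, 2 ≤ m k) (hp : 1 ≤ p) (hf : InLp m p f) {r : ℕ}
    {s : Finset ℕ} (hs : ∀ j ∈ s, M m r ≤ j) {w : ℕ → ℝ} {a A C D : ℝ} (ha : ‖a‖ ≤ A)
    (hC : l1Norm (haar₂ m) (∑ j ∈ s, w j • dirichlet₂ m j) ≤ C) (hD : A * (2 * C) ≤ D) :
    normLp m p (a • ∑ j ∈ s, w j • (partialSum m j j f - f)) ≤
      ENNReal.ofReal D * (modulus₁ m p f r + modulus₂ m p f r) := by
  have : 0 ≤ C := (apply_nonneg _ _).trans hC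
  calc _ ≤ ENNReal.ofReal A * (2 * (ENNReal.ofReal C * (modulus₁ m p f r + modulus₂ m p f r))) := by
        refine (normLp_smul_le a).trans (mul_le_mul' ?_
          ((normLp_sum_smul_partialSum_sub_le hm hp hf hs w).trans (by gcongr)))
        rw [← ofReal_norm]
        exact ENNReal.ofReal_le_ofReal ha
    _ = ENNReal.ofReal (A * (2 * C)) * (modulus₁ m p f r + modulus₂ m p f r) := by
        rw [ENNReal.ofReal_mul ((norm_nonneg a).trans ha), ENNReal.ofReal_mul two_pos.le,
          ENNReal.ofReal_ofNat]
        ring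
    _ ≤ _ := by gcongr

end Approximation

section CesaroMeans

variable {m : ℕ → ℕ} [∀ k, NeZero (m k)] {p : ℝ≥0∞} {f : Group m × Group m → ℂ} {α : ℝ}

/-- The constant of the approximation theorem for the `(C, -α)` means. The factor `(1 - α)⁻¹` comes
from `1 / A_{N-1}^{-α} ≤ (1 - α)⁻¹ N ^ α`, and the two summands from the top block and from the
lower blocks. -/
def approxConst (α : ℝ) (B : ℕ) : ℝ :=
  (1 - α)⁻¹ * (2 * upperKernelConst B + 16 * marcinkiewiczConst B * B)

lemma upperKernelConst_nonneg (B : ℕ) : 0 ≤ upperKernelConst B := by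
  have := fejerConst_nonneg B
  have := marcinkiewiczConst_nonneg B
  unfold upperKernelConst; positivity

lemma sum_Ico_one_M {E : Type*} [AddCommMonoid E] (F : ℕ → E) (n : ℕ) :
    ∑ j ∈ Finset.Ico 1 (M m n), F j =
      ∑ r ∈ Finset.range n, ∑ j ∈ Finset.Ico (M m r) (M m (r + 1)), F j := by
  induction n with
  | zero => simp [M]
  | succ n ih =>
    rw [Finset.sum_range_succ, ← ih, Finset.sum_Ico_consecutive _ (M_pos n) (M_mono n.le_succ)]

lemma sum_Ico_one_cesaroNumber (a : ℝ) {N : ℕ} (hN : 0 < N) :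
    ∑ j ∈ Finset.Ico 1 (N + 1), cesaroNumber (a - 1) (N - j) = cesaroNumber a (N - 1) := by
  rw [← sum_cesaroNumber, Nat.sub_add_cancel hN, ← Finset.sum_range_reflect,
    Finset.sum_Ico_eq_sum_range, Nat.add_sub_cancel]
  exact Finset.sum_congr rfl fun j _ => by rw [Nat.sub_sub]

lemma cesaroMean_sub_self (hα : α < 1) {N : ℕ} (hN : 0 < N) (f : Group m × Group m → ℂ) :
    cesaroMean m (-α) N f - f = (1 / cesaroNumber (-α) (N - 1)) •
      ∑ j ∈ Finset.Ico 1 (N + 1), cesaroNumber (-α - 1) (N - j) • (partialSum m j j f - f) := by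
  have hA : cesaroNumber (-α) (N - 1) ≠ 0 := (cesaroNumber_neg_pos hα (N - 1)).ne'
  simp only [smul_sub, Finset.sum_sub_distrib]
  rw [← Finset.sum_smul, sum_Ico_one_cesaroNumber _ hN, smul_smul, one_div_mul_cancel hA, one_smul]
  ext z
  simp only [Pi.sub_apply, Pi.smul_apply, Finset.sum_apply, Complex.real_smul, cesaroMean]
  rfl

lemma cesaroMean_M_sub_self (hα : α < 1) (n : ℕ) (f : Group m × Group m → ℂ) :
    let N := M m (n + 1)
    let A := 1 / cesaroNumber (-α) (N - 1)
    let F := fun j => cesaroNumber (-α - 1) (N - j) • (partialSum m j j f - f)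
    cesaroMean m (-α) N f - f = (A • ∑ j ∈ Finset.Ico (M m n) (N + 1), F j) +
      ∑ r ∈ Finset.range n, A • ∑ j ∈ Finset.Ico (M m r) (M m (r + 1)), F j := by
  intro N A F
  rw [cesaroMean_sub_self hα (M_pos _), ← Finset.smul_sum, ← smul_add, ← sum_Ico_one_M,
    add_comm (∑ j ∈ Finset.Ico (M m n) (N + 1), F j),
    Finset.sum_Ico_consecutive _ (M_pos n) ((M_mono n.le_succ).trans (Nat.le_add_right _ 1))]

lemma norm_one_div_cesaroNumber_neg_le (hα₀ : 0 ≤ α) (hα₁ : α < 1) {n : ℕ} (hn : 1 ≤ n) :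
    ‖1 / cesaroNumber (-α) (n - 1)‖ ≤ (1 - α)⁻¹ * (n : ℝ) ^ α := by
  rw [Real.norm_of_nonneg (one_div_nonneg.2 (cesaroNumber_neg_pos hα₁ _).le)]
  exact one_div_cesaroNumber_neg_le hα₀ hα₁ hn

lemma normLp_upperBlock_le (hm : ∀ k, 2 ≤ m k) {B : ℕ} (hB : ∀ k, m k ≤ B) (hα₀ : 0 ≤ α)
    (hα₁ : α < 1) (hp : 1 ≤ p) (hf : InLp m p f) (n : ℕ) :
    normLp m p ((1 / cesaroNumber (-α) (M m (n + 1) - 1)) •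
      ∑ j ∈ Finset.Ico (M m n) (M m (n + 1) + 1),
        cesaroNumber (-α - 1) (M m (n + 1) - j) • (partialSum m j j f - f)) ≤
      ENNReal.ofReal (approxConst α B * (M m (n + 1) : ℝ) ^ α) *
        (modulus₁ m p f n + modulus₂ m p f n) := by
  refine normLp_smul_block_le hm hp hf (fun j hj => (Finset.mem_Ico.1 hj).1)
    (norm_one_div_cesaroNumber_neg_le hα₀ hα₁ (M_pos _)) (l1Norm_upperKernel_le hm hB hα₀ hα₁ n) ?_
  have : 0 < (1 - α)⁻¹ := inv_pos.2 (sub_pos.2 hα₁)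
  have hM := marcinkiewiczConst_nonneg B
  rw [mul_right_comm, approxConst]
  gcongr
  exact le_add_of_nonneg_right (by positivity)

lemma normLp_lowerBlock_le (hm : ∀ k, 2 ≤ m k) {B : ℕ} (hB : ∀ k, m k ≤ B) (hα₀ : 0 ≤ α)
    (hα₁ : α < 1) (hp : 1 ≤ p) (hf : InLp m p f) {r n : ℕ} (hr : r < n) :
    normLp m p ((1 / cesaroNumber (-α) (M m (n + 1) - 1)) •
      ∑ j ∈ Finset.Ico (M m r) (M m (r + 1)),
        cesaroNumber (-α - 1) (M m (n + 1) - j) • (partialSum m j j f - f)) ≤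
      ENNReal.ofReal (approxConst α B * (M m r / M m (n + 1))) *
        (modulus₁ m p f r + modulus₂ m p f r) := by
  refine normLp_smul_block_le hm hp hf (fun j hj => (Finset.mem_Ico.1 hj).1)
    (norm_one_div_cesaroNumber_neg_le hα₀ hα₁ (M_pos _)) (l1Norm_lowerKernel_le hm hB hα₀ hα₁ hr) ?_
  have hN : (0 : ℝ) < M m (n + 1) := Nat.cast_pos.2 (M_pos _)
  have : 0 < (1 - α)⁻¹ := inv_pos.2 (sub_pos.2 hα₁)
  have hU := upperKernelConst_nonneg B
  have hpow : (M m (n + 1) : ℝ) ^ α * (M m (n + 1) : ℝ) ^ (-1 - α) = (M m (n + 1) : ℝ)⁻¹ := by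
    rw [← Real.rpow_add hN, ← Real.rpow_neg_one, add_sub_cancel]
  calc _ = (1 - α)⁻¹ * (16 * marcinkiewiczConst B * B) * (M m r *
        ((M m (n + 1) : ℝ) ^ α * (M m (n + 1) : ℝ) ^ (-1 - α))) := by ring
    _ = (1 - α)⁻¹ * (16 * marcinkiewiczConst B * B) * (M m r / M m (n + 1)) := by
        rw [hpow, div_eq_mul_inv]
    _ ≤ _ := by
        rw [approxConst]
        gcongr
        exact le_add_of_nonneg_left (by positivity)

lemma approxConst_nonneg (hα : α < 1) (B : ℕ) : 0 ≤ approxConst α B := by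
  have := inv_pos.2 (sub_pos.2 hα)
  have := upperKernelConst_nonneg B
  have := marcinkiewiczConst_nonneg B
  unfold approxConst; positivity

lemma normLp_cesaroMean_M_sub_le (hm : ∀ k, 2 ≤ m k) {B : ℕ} (hB : ∀ k, m k ≤ B) (hα₀ : 0 ≤ α)
    (hα₁ : α < 1) (hp : 1 ≤ p) (hf : InLp m p f) (n : ℕ) :
    normLp m p (cesaroMean m (-α) (M m (n + 1)) f - f) ≤
      ENNReal.ofReal (approxConst α B) *
        ((M m (n + 1) : ℝ≥0∞) ^ α * (modulus₁ m p f n + modulus₂ m p f n) +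
          ∑ r ∈ Finset.range n, (M m r : ℝ≥0∞) / (M m (n + 1) : ℝ≥0∞) *
            (modulus₁ m p f r + modulus₂ m p f r)) := by
  have hmem (s : Finset ℕ) (a : ℝ) (w : ℕ → ℝ) :
      InLp m p (a • ∑ j ∈ s, w j • (partialSum m j j f - f)) :=
    (InLp.sum s fun j _ =>
      ((InLp.of_continuous (continuous_partialSum j j f)).sub hf).smul (w j)).smul a
  have hc := approxConst_nonneg hα₁ B
  have hM (r : ℕ) : (0 : ℝ) < M m r := Nat.cast_pos.2 (M_pos r)
  rw [cesaroMean_M_sub_self hα₁, mul_add, ← mul_assoc, Finset.mul_sum]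
  refine (normLp_add_le hp (hmem _ _ _) (InLp.sum _ fun r _ => hmem _ _ _)).trans
    (add_le_add ?_ ((normLp_sum_le hp _ fun r _ => hmem _ _ _).trans
      (Finset.sum_le_sum fun r hr => ?_)))
  · refine (normLp_upperBlock_le hm hB hα₀ hα₁ hp hf n).trans_eq ?_
    rw [ENNReal.ofReal_mul hc, ← ENNReal.ofReal_rpow_of_pos (hM _), ENNReal.ofReal_natCast]
  · refine (normLp_lowerBlock_le hm hB hα₀ hα₁ hp hf (Finset.mem_range.1 hr)).trans_eq ?_
    rw [ENNReal.ofReal_mul hc, ENNReal.ofReal_div_of_pos (hM _), ENNReal.ofReal_natCast,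
      ENNReal.ofReal_natCast, mul_assoc]

end CesaroMeans

end Vilenkin

end

theorem theorem1 (α : ℝ) (hα₀ : 0 < α) (hα₁ : α < 1) (B : ℕ) :
    ∃ c : ℝ≥0, ∀ (m : ℕ → ℕ) [∀ k, NeZero (m k)], (∀ k, 2 ≤ m k) → (∀ k, m k ≤ B) →
      ∀ p : ℝ≥0∞, 1 ≤ p →
      ∀ f : Vilenkin.Group m × Vilenkin.Group m → ℂ, Vilenkin.InLp m p f →
      ∀ k : ℕ, 1 ≤ k →
        Vilenkin.normLp m p
            (fun z => Vilenkin.cesaroMean m (-α) (Vilenkin.M m k) f z - f z) ≤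
          (c : ℝ≥0∞) *
            ((Vilenkin.M m k : ℝ≥0∞) ^ α * Vilenkin.modulus₁ m p f (k - 1) +
              (Vilenkin.M m k : ℝ≥0∞) ^ α * Vilenkin.modulus₂ m p f (k - 1) +
              ∑ r ∈ Finset.range (k - 1),
                (Vilenkin.M m r : ℝ≥0∞) / (Vilenkin.M m k : ℝ≥0∞) *
                  (Vilenkin.modulus₁ m p f r + Vilenkin.modulus₂ m p f r)) := by
  refine ⟨(Vilenkin.approxConst α B).toNNReal, fun m _ hm hB p hp f hf k hk => ?_⟩
  obtain ⟨n, rfl⟩ := Nat.exists_eq_add_of_le' hk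
  rw [← mul_add]
  exact Vilenkin.normLp_cesaroMean_M_sub_le hm hB hα₀.le hα₁ hp hf n
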